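/- **Setting.** Fix $m\in\mathbb N$ and, for every $i\le m$, one of the following three types: (a) finite $k_i$-marked measures, (b) $k_i$-marked compact subsets, (c) convergent continuous curves; in (a) and (b), $k_i\in\mathbb N$ and a complete separable metric space $\Xi_i$ (the mark space) are also fixed. For a compact metric space $X$, the product $X^{k}\times\Xi$ carries the max product metric. A finite $k$-marked measure on $X$ is a finite Borel measure on $X^k\times\Xi$; a $k$-marked compact subset is a (possibly empty) compact subset of $X^k\times\Xi$; a convergent continuous curve is a continuous map $\eta:\mathbb R\to X$ such that $\eta(t)$ converges in $X$ as $t\to\infty$ and as $t\to-\infty$. Let $\tau(X)$ be the set of tuples $a=(a_1,\dots,a_m)$ where $a_i$ is a structure on $X$ of the $i$-th type. Equip $\tau(X)$ with $d(a,b)=\max_i d(a_i,b_i)$, where $d(a_i,b_i)$ is, respectively, the Prokhorov distance, the Hausdorff distance (with $d_H(\emptyset,K)=\infty$ for $K\neq\emptyset$), or the sup distance $\sup_t d(a_i(t),b_i(t))$. An isometric embedding $f:X\to Z$ induces $\tau_f:\tau(X)\to\tau(Z)$ componentwise: push-forward of marked measures and image of marked sets under $(x_1,\dots,x_k,\xi)\mapsto(f(x_1),\dots,f(x_k),\xi)$,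 and $\eta\mapsto f\circ\eta$ for curves. Let $\mathcal C_\tau$ be the space of equivalence classes of pairs $(X,a)$, where $X$ is a compact metric space and $a\in\tau(X)$, with $(X,a)\sim(X',a')$ if $\tau_f(a)=a'$ for some isometry $f$ of $X$ onto $X'$. On $\mathcal C_\tau$ put the (extended) metric $$d^c_\tau\big((X,a),(Y,b)\big)=\inf_{Z,f,g}\max\big\{d_H(f(X),g(Y)),\ d(\tau_f(a),\tau_g(b))\big\},$$ the infimum being over all compact metric spaces $Z$ and isometric embeddings $f:X\to Z$, $g:Y\to Z$. A correspondence between $X$ and $Y$ is a set $R\subseteq X\times Y$ that projects onto both $X$ and $Y$; its distortion is $\operatorname{dis}(R)=\sup\{|d(x,x')-d(y,y')|:(x,y),(x',y')\in R\}$. For $\epsilon\ge0$ let $$R_{k,\epsilon}=\{((x_1,\dots,x_k,\xi),(y_1,\dots,y_k,\xi')):\ (x_j,y_j)\in R\ \text{for all } j,\ d(\xi,\xi')\le\epsilon\}.$$ For a finite Borel measure $\alpha$ on a product $S\times T$ with projections $\pi_1,\pi_2$, and finite Borel measures $\mu$ on $S$ and $\nu$ on $T$, let $D(\alpha;\mu,\nu)=\|\pi_{1*}\alpha-\mu\|+\|\pi_{2*}\alpha-\nu\|$,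 where $\|\mu-\mu'\|=\sup_A|\mu(A)-\mu'(A)|$ over Borel sets $A$. **Proposition 3.16.** Let $\mathcal X=(X,a_1,\dots,a_m)$ and $\mathcal Y=(Y,b_1,\dots,b_m)$ be elements of $\mathcal C_\tau$ and let $\epsilon\ge0$. Then $d^c_\tau(\mathcal X,\mathcal Y)\le\epsilon$ if and only if there exists a correspondence $R$ between $X$ and $Y$ such that $\operatorname{dis}(R)\le2\epsilon$ and, for each $i\le m$: 1. if $a_i$ and $b_i$ are $k$-marked compact subsets with mark space $\Xi$, then for every $p\in a_i$ there is $q\in b_i$ with $(p,q)\in R_{k,\epsilon}$, and for every $q\in b_i$ there is $p\in a_i$ with $(p,q)\in R_{k,\epsilon}$; 2. if $a_i$ and $b_i$ are $k$-marked measures with mark space $\Xi$, then there is a finite Borel measure $\alpha$ on $(X^k\times\Xi)\times(Y^k\times\Xi)$ such that $D(\alpha;a_i,b_i)+\alpha(R_{k,\epsilon}^c)\le\epsilon$ (where $\alpha$ is extended to all subsets as an outer measure); 3. if $a_i$ and $b_i$ are curves, then $(a_i(t),b_i(t))\in R$ for all $t\in\mathbb R$. -/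

import Mathlib

open Set Filter Topology MeasureTheory
open scoped ENNReal NNReal

universe u

noncomputable section

namespace GHFunctor

/-! ### Marks -/

/-- A mark space: a complete separable metric space. -/
structure MarkSpace : Type (u + 1) where
  carrier : Type u
  [metric : MetricSpace carrier]
  [complete : CompleteSpace carrier]
  [separable : TopologicalSpace.SeparableSpace carrier]

instance : CoeSort MarkSpace.{u} (Type u) := ⟨MarkSpace.carrier⟩

attribute [instance] MarkSpace.metric MarkSpace.complete MarkSpace.separable

/-- The product `X ^ k × Ξ`, with the max product metric and its Borel sigma-algebra. -/
def Marked (k : ℕ) (X Ξ : Type u) : Type u := (Fin k → X) × Ξ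

namespace Marked

variable {k : ℕ} {X Z Ξ : Type u}

instance [MetricSpace X] [MetricSpace Ξ] : MetricSpace (Marked k X Ξ) :=
  inferInstanceAs (MetricSpace ((Fin k → X) × Ξ))

instance [MetricSpace X] [MetricSpace Ξ] : MeasurableSpace (Marked k X Ξ) := borel _

instance [MetricSpace X] [MetricSpace Ξ] : BorelSpace (Marked k X Ξ) := ⟨rfl⟩

/-- The map `(x₁, …, x_k, ξ) ↦ (f x₁, …, f x_k, ξ)`. -/
def map (f : X → Z) (p : Marked k X Ξ) : Marked k Z Ξ := (fun j => f (p.1 j), p.2)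

theorem continuous_map [MetricSpace X] [MetricSpace Z] [MetricSpace Ξ] {f : X → Z}
    (hf : Isometry f) : Continuous (map f : Marked k X Ξ → Marked k Z Ξ) := by
  have hc := hf.continuous
  change Continuous (fun p : (Fin k → X) × Ξ => ((fun j => f (p.1 j), p.2) : (Fin k → Z) × Ξ))
  fun_prop

end Marked

/-! ### Curves -/

/-- Continuous curves `ℝ → X` which converge at `+∞` and at `-∞`. -/
@[ext]
structure ConvergentCurve (X : Type u) [MetricSpace X] : Type u where
  toFun : ℝ → X
  continuous_toFun : Continuous toFun
  tendsto_atTop : ∃ x, Tendsto toFun atTop (𝓝 x)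
  tendsto_atBot : ∃ x, Tendsto toFun atBot (𝓝 x)

/-- The curve `f ∘ η`. -/
def ConvergentCurve.map {X Z : Type u} [MetricSpace X] [MetricSpace Z] (f : X → Z)
    (hf : Continuous f) (η : ConvergentCurve X) : ConvergentCurve Z where
  toFun := f ∘ η.toFun
  continuous_toFun := hf.comp η.continuous_toFun
  tendsto_atTop := η.tendsto_atTop.elim fun x hx => ⟨f x, (hf.tendsto x).comp hx⟩
  tendsto_atBot := η.tendsto_atBot.elim fun x hx => ⟨f x, (hf.tendsto x).comp hx⟩

/-! ### The additional structures -/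

/-- The possible types of one component of the additional structure: finite `k`-marked measures,
`k`-marked compact subsets (with mark space `Ξ`), or convergent continuous curves. -/
inductive Kind : Type (u + 1)
  | measure (k : ℕ) (Ξ : MarkSpace.{u}) : Kind
  | compact (k : ℕ) (Ξ : MarkSpace.{u}) : Kind
  | curve : Kind

namespace Kind

/-- The set of structures of the given type on `X`. The empty marked compact subset is allowed. -/
def Str (X : Type u) [MetricSpace X] : Kind.{u} → Type u
  | measure k Ξ => FiniteMeasure (Marked k X Ξ)
  | compact k Ξ => TopologicalSpace.Compacts (Marked k X Ξ)
  | curve => ConvergentCurve X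

/-- The Prokhorov distance of finite marked measures, the Hausdorff distance of marked compact
subsets (which is `∞` between the empty set and a nonempty set), and the sup distance of curves. -/
def strDist {X : Type u} [MetricSpace X] : (κ : Kind.{u}) → κ.Str X → κ.Str X → ℝ≥0∞
  | measure k Ξ => fun (μ ν : FiniteMeasure (Marked k X Ξ)) =>
      levyProkhorovEDist (μ : Measure (Marked k X Ξ)) (ν : Measure (Marked k X Ξ))
  | compact k Ξ => fun (K L : TopologicalSpace.Compacts (Marked k X Ξ)) =>
      Metric.hausdorffEDist (K : Set (Marked k X Ξ)) (L : Set (Marked k X Ξ))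
  | curve => fun (η ζ : ConvergentCurve X) =>
      ⨆ t : ℝ, edist (η.toFun t) (ζ.toFun t)

/-- The map on structures induced by an isometric embedding: push-forward of measures, image of
compact subsets, composition with curves. -/
def push {X Z : Type u} [MetricSpace X] [MetricSpace Z] (f : X → Z) (hf : Isometry f) :
    (κ : Kind.{u}) → κ.Str X → κ.Str Z
  | measure _ _ => fun μ => FiniteMeasure.map μ (Marked.map f)
  | compact _ _ => TopologicalSpace.Compacts.map (Marked.map f) (Marked.continuous_map hf)
  | curve => ConvergentCurve.map f hf.continuous

theorem push_id {X : Type u} [MetricSpace X] (h : Isometry (id : X → X)) (κ : Kind.{u})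
    (a : κ.Str X) : κ.push id h a = a := by
  cases κ with
  | measure k Ξ =>
    refine Subtype.ext ?_
    change Measure.map (Marked.map id) (Subtype.val (a : FiniteMeasure (Marked k X Ξ))) = _
    exact Measure.map_id
  | compact k Ξ => exact TopologicalSpace.Compacts.map_id _
  | curve => rfl

theorem push_comp {X Y Z : Type u} [MetricSpace X] [MetricSpace Y] [MetricSpace Z]
    {f : X → Y} {g : Y → Z} (hf : Isometry f) (hg : Isometry g) (κ : Kind.{u}) (a : κ.Str X) :
    κ.push (g ∘ f) (hg.comp hf) a = κ.push g hg (κ.push f hf a) := by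
  cases κ with
  | measure k Ξ =>
    refine Subtype.ext ?_
    change Measure.map (Marked.map g ∘ Marked.map f)
      (Subtype.val (a : FiniteMeasure (Marked k X Ξ))) = Measure.map _ (Measure.map _ _)
    exact (Measure.map_map (Marked.continuous_map hg).measurable
      (Marked.continuous_map hf).measurable).symm
  | compact k Ξ =>
    exact TopologicalSpace.Compacts.map_comp (Marked.map g) (Marked.map f)
      (Marked.continuous_map hg) (Marked.continuous_map hf) a
  | curve => rfl

end Kind

/-! ### The tuple functor `τ` determined by the types `κ 1, …, κ m` -/

variable {m : ℕ}

/-- `τ(X)`: the tuples `(a₁, …, a_m)` in which `a_i` is a structure of type `κ i` on `X`. -/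
def Tuple (κ : Fin m → Kind.{u}) (X : Type u) [MetricSpace X] : Type u := ∀ i, (κ i).Str X

/-- The max product (extended) metric on `τ(X)`. -/
def tupleDist (κ : Fin m → Kind.{u}) {X : Type u} [MetricSpace X] (a b : Tuple κ X) : ℝ≥0∞ :=
  ⨆ i, (κ i).strDist (a i) (b i)

/-- The map `τ_f : τ(X) → τ(Z)` induced by an isometric embedding `f : X → Z`. -/
def tuplePush (κ : Fin m → Kind.{u}) {X Z : Type u} [MetricSpace X] [MetricSpace Z] (f : X → Z)
    (hf : Isometry f) (a : Tuple κ X) : Tuple κ Z := fun i => (κ i).push f hf (a i)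

/-- Pairs `(X, a)` of a compact metric space `X` and `a ∈ τ(X)`. -/
structure Obj (κ : Fin m → Kind.{u}) : Type (u + 1) where
  carrier : Type u
  [metric : MetricSpace carrier]
  [compact : CompactSpace carrier]
  str : Tuple κ carrier

attribute [instance] Obj.metric Obj.compact

/-- `(X, a)` and `(X', a')` are equivalent if `τ_f(a) = a'` for some isometry `f` of `X`
onto `X'`. -/
def Obj.Equivalent {κ : Fin m → Kind.{u}} (A B : Obj κ) : Prop :=
  ∃ f : A.carrier ≃ᵢ B.carrier, tuplePush κ f f.isometry A.str = B.str

theorem Obj.equivalent_equivalence (κ : Fin m → Kind.{u}) :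
    Equivalence (Obj.Equivalent (κ := κ)) where
  refl A := ⟨IsometryEquiv.refl _, funext fun i => Kind.push_id _ _ _⟩
  symm := by
    rintro A B ⟨f, hf⟩
    refine ⟨f.symm, funext fun i => ?_⟩
    rw [← hf]
    change (κ i).push _ _ ((κ i).push _ _ _) = _
    rw [← Kind.push_comp]
    have h : (f.symm ∘ f : A.carrier → A.carrier) = id := funext fun x => f.symm_apply_apply x
    simp only [h, Kind.push_id]
  trans := by
    rintro A B C ⟨f, hf⟩ ⟨g, hg⟩
    refine ⟨f.trans g, funext fun i => ?_⟩
    rw [← hg, ← hf]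
    exact Kind.push_comp f.isometry g.isometry _ _

/-- The equivalence of pairs `(X, a)`, as a setoid. -/
def objSetoid (κ : Fin m → Kind.{u}) : Setoid (Obj κ) :=
  ⟨Obj.Equivalent, Obj.equivalent_equivalence κ⟩

/-- The formula
`inf_{Z, f, g} max (d_H (f(X), g(Y))) (d (τ_f(a), τ_g(b)))`,
over all compact metric spaces `Z` and isometric embeddings `f : X → Z` and `g : Y → Z`. -/
def objDist {κ : Fin m → Kind.{u}} (A B : Obj κ) : ℝ≥0∞ :=
  ⨅ (Z : Type u) (_ : MetricSpace Z) (_ : CompactSpace Z)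
    (f : A.carrier → Z) (hf : Isometry f) (g : B.carrier → Z) (hg : Isometry g),
    max (Metric.hausdorffEDist (range f) (range g))
      (tupleDist κ (tuplePush κ f hf A.str) (tuplePush κ g hg B.str))

theorem objDist_le_of_equivalent {κ : Fin m → Kind.{u}} {A B A' B' : Obj κ}
    (hA : A.Equivalent A') (hB : B.Equivalent B') : objDist A B ≤ objDist A' B' := by
  obtain ⟨φ, hφ⟩ := hA
  obtain ⟨ψ, hψ⟩ := hB
  refine le_iInf fun Z => le_iInf fun _ => le_iInf fun _ => le_iInf fun f => le_iInf fun hf =>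
    le_iInf fun g => le_iInf fun hg => ?_
  refine iInf_le_of_le Z <| iInf_le_of_le _ <| iInf_le_of_le ‹_› <| iInf_le_of_le (f ∘ φ) <|
    iInf_le_of_le (hf.comp φ.isometry) <| iInf_le_of_le (g ∘ ψ) <|
    iInf_le_of_le (hg.comp ψ.isometry) ?_
  have h1 : tuplePush κ (f ∘ φ) (hf.comp φ.isometry) A.str = tuplePush κ f hf A'.str := by
    rw [← hφ]
    exact funext fun i => Kind.push_comp φ.isometry hf _ _
  have h2 : tuplePush κ (g ∘ ψ) (hg.comp ψ.isometry) B.str = tuplePush κ g hg B'.str := by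
    rw [← hψ]
    exact funext fun i => Kind.push_comp ψ.isometry hg _ _
  rw [h1, h2, φ.surjective.range_comp, ψ.surjective.range_comp]

/-- The space `C_τ` of equivalence classes of pairs `(X, a)`. -/
def Space (κ : Fin m → Kind.{u}) : Type (u + 1) := Quotient (objSetoid κ)

/-- The equivalence class of `(X, a)`. -/
def toSpace (κ : Fin m → Kind.{u}) (X : Type u) [MetricSpace X] [CompactSpace X]
    (a : Tuple κ X) : Space κ := Quotient.mk (objSetoid κ) ⟨X, a⟩

/-- The Gromov-Hausdorff-functor (extended) metric on `C_τ`. -/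
def ghDist {κ : Fin m → Kind.{u}} : Space κ → Space κ → ℝ≥0∞ :=
  Quotient.lift₂ (s₁ := objSetoid κ) (s₂ := objSetoid κ) objDist fun _ _ _ _ h₁ h₂ =>
    le_antisymm (objDist_le_of_equivalent h₁ h₂)
      (objDist_le_of_equivalent ((objSetoid κ).symm h₁) ((objSetoid κ).symm h₂))

/-! ### Correspondences and discrepancy -/

/-- A relation whose projections to both factors are surjective. -/
def IsCorrespondence {X Y : Type u} (R : Set (X × Y)) : Prop :=
  Prod.fst '' R = univ ∧ Prod.snd '' R = univ

/-- The distortion `sup {|d(x, x') - d(y, y')| : (x, y), (x', y') ∈ R}`. -/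
def distortion {X Y : Type u} [MetricSpace X] [MetricSpace Y] (R : Set (X × Y)) : ℝ≥0∞ :=
  ⨆ (p ∈ R) (q ∈ R), ENNReal.ofReal |dist p.1 q.1 - dist p.2 q.2|

/-- The relation `R_{k, ε}` between `X ^ k × Ξ` and `Y ^ k × Ξ`. -/
def markedRel {X Y : Type u} (R : Set (X × Y)) (k : ℕ) (Ξ : Type u) [MetricSpace Ξ] (ε : ℝ≥0) :
    Set (Marked k X Ξ × Marked k Y Ξ) :=
  {p | (∀ j, (p.1.1 j, p.2.1 j) ∈ R) ∧ dist p.1.2 p.2.2 ≤ ε}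

/-- The total variation distance `sup_A |μ(A) - ν(A)|` of finite measures. -/
def tvDist {S : Type u} [MeasurableSpace S] (μ ν : Measure S) : ℝ≥0∞ :=
  ⨆ (A : Set S) (_ : MeasurableSet A), ENNReal.ofReal |μ.real A - ν.real A|

/-- The discrepancy `D(α; μ, ν)` of a finite measure `α` on `S × T`. -/
def discrepancy {S T : Type u} [MeasurableSpace S] [MeasurableSpace T] (α : Measure (S × T))
    (μ : Measure S) (ν : Measure T) : ℝ≥0∞ :=
  tvDist (α.map Prod.fst) μ + tvDist (α.map Prod.snd) ν

/-- The condition that a relation `R` between `X` and `Y` imposes on a structure on `X` and a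
structure on `Y` of the same type. A finite measure `α` is evaluated at the complement of
`R_{k, ε}` as an outer measure when that set is not measurable. -/
def Kind.Compatible {X Y : Type u} [MetricSpace X] [MetricSpace Y] (R : Set (X × Y)) (ε : ℝ≥0) :
    (κ : Kind.{u}) → κ.Str X → κ.Str Y → Prop
  | compact k Ξ => fun (K : TopologicalSpace.Compacts (Marked k X Ξ))
      (L : TopologicalSpace.Compacts (Marked k Y Ξ)) =>
      (∀ p ∈ K, ∃ q ∈ L, (p, q) ∈ markedRel R k Ξ ε) ∧
        ∀ q ∈ L, ∃ p ∈ K, (p, q) ∈ markedRel R k Ξ ε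
  | measure k Ξ => fun (μ : FiniteMeasure (Marked k X Ξ)) (ν : FiniteMeasure (Marked k Y Ξ)) =>
      ∃ α : Measure (Marked k X Ξ × Marked k Y Ξ), IsFiniteMeasure α ∧
        discrepancy α (μ : Measure (Marked k X Ξ)) (ν : Measure (Marked k Y Ξ)) +
          α (markedRel R k Ξ ε)ᶜ ≤ ε
  | curve => fun (η : ConvergentCurve X) (ζ : ConvergentCurve Y) =>
      ∀ t : ℝ, (η.toFun t, ζ.toFun t) ∈ R

end GHFunctor

end

/-! From a correspondence to a bound: since `dis(R) ≤ 2ε`, the disjoint union of `X` and `Y` can be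
metrized so that `R`-related points lie at distance `ε + δ`, for any `δ > 0`. Each compatibility
condition then bounds the corresponding distance in the glued space by `ε + δ`, and the infimum
defining `objDist` absorbs `δ`. This also covers `ε = 0`.

From a bound to a correspondence: no optimal embedding space is constructed. The cross distances
`d(f(x), g(y))` of nearly optimal embeddings are functions on the fixed compact space `X × Y`,
uniformly bounded and 2-Lipschitz, so by Arzelà–Ascoli a subsequence converges uniformly to some `F`
(`exists_crossDist_of_objDist_le`). The correspondence is `R = {F ≤ ε}`. Its distortion bound is the
quadrilateral inequality in the limit; surjectivity and the matching of marked sets follow from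
compactness, and curves pass to the limit pointwise.

Measures need Strassen's theorem. Prokhorov inequalities on compact sets pass to the limit by
continuity from above and give a Hall condition for the closed relation `R_{k,ε}`. The sublinear
functional `h ↦ inf {∫ u dμ + ∫ v dν : h ≤ u + v on R_{k,ε}, u, v ≥ 0}` dominates a linear
functional with the same value at `1` (Hahn–Banach). The Riesz theorem makes it a measure carried by
`R_{k,ε}` with marginals below `μ` and `ν`, and the layer-cake formula with the Hall condition shows
that it misses at most mass `ε` of each. A multiple of the product of the two residual measures is
added, so that the two missing masses are not both charged to the discrepancy. -/

noncomputable section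

namespace GHFunctor

/-! ### Measures with dominated marginals on a closed relation -/

section Strassen

variable {S T : Type*} [MeasurableSpace S] [MeasurableSpace T]

/-- The values `∫ u dμ + ∫ v dν` for nonnegative integrable `u`, `v` with `h ≤ u + v` on `R`. -/
def dualValues (μ : Measure S) (ν : Measure T) (R : Set (S × T)) (h : S × T → ℝ) : Set ℝ :=
  {r | ∃ u v, Measurable u ∧ Measurable v ∧ Integrable u μ ∧ Integrable v ν ∧ 0 ≤ u ∧ 0 ≤ v ∧
    (∀ z ∈ R, h z ≤ u z.1 + v z.2) ∧ r = ∫ x, u x ∂μ + ∫ y, v y ∂ν}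

/-! ### Sublinearity of the dual problem -/

section dualValues

variable {μ : Measure S} {ν : Measure T} {R : Set (S × T)} {h h' : S × T → ℝ}

theorem nonneg_of_mem_dualValues {r : ℝ} (hr : r ∈ dualValues μ ν R h) : 0 ≤ r := by
  obtain ⟨u, v, -, -, -, -, hu, hv, -, rfl⟩ := hr
  exact add_nonneg (integral_nonneg hu) (integral_nonneg hv)

theorem bddBelow_dualValues : BddBelow (dualValues μ ν R h) :=
  ⟨0, fun _ hr => nonneg_of_mem_dualValues hr⟩

theorem dualValues_nonempty [IsFiniteMeasure μ] {C : ℝ} (hC : ∀ z, h z ≤ C) :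
    (dualValues μ ν R h).Nonempty := by
  refine ⟨_, fun _ => max C 0, fun _ => 0, measurable_const, measurable_const,
    integrable_const _, integrable_zero _ _ _, fun _ => le_max_right _ _, fun _ => le_rfl,
    fun z _ => ?_, rfl⟩
  simpa using Or.inl (hC z)

theorem add_mem_dualValues {r r' : ℝ} (hr : r ∈ dualValues μ ν R h)
    (hr' : r' ∈ dualValues μ ν R h') : r + r' ∈ dualValues μ ν R (h + h') := by
  obtain ⟨u, v, hu, hv, iu, iv, pu, pv, hle, rfl⟩ := hr
  obtain ⟨u', v', hu', hv', iu', iv', pu', pv', hle', rfl⟩ := hr'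
  refine ⟨u + u', v + v', hu.add hu', hv.add hv', iu.add iu', iv.add iv', add_nonneg pu pu',
    add_nonneg pv pv', fun z hz => ?_, ?_⟩
  · simp only [Pi.add_apply]
    linarith [hle z hz, hle' z hz]
  · rw [integral_add' iu iu', integral_add' iv iv']
    ring

theorem mul_mem_dualValues {r c : ℝ} (hc : 0 ≤ c) (hr : r ∈ dualValues μ ν R h) :
    c * r ∈ dualValues μ ν R (c • h) := by
  obtain ⟨u, v, hu, hv, iu, iv, pu, pv, hle, rfl⟩ := hr
  refine ⟨c • u, c • v, hu.const_smul c, hv.const_smul c, iu.smul c, iv.smul c,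
    smul_nonneg hc pu, smul_nonneg hc pv, fun z hz => ?_, ?_⟩
  · simp only [Pi.smul_apply, smul_eq_mul]
    nlinarith [hle z hz]
  · simp only [Pi.smul_apply, smul_eq_mul, integral_const_mul]
    ring

theorem mul_mem_dualValues_iff {r c : ℝ} (hc : 0 < c) :
    c * r ∈ dualValues μ ν R (c • h) ↔ r ∈ dualValues μ ν R h := by
  refine ⟨fun hr => ?_, mul_mem_dualValues hc.le⟩
  have := mul_mem_dualValues (inv_nonneg.2 hc.le) hr
  rwa [inv_mul_cancel_left₀ hc.ne', inv_smul_smul₀ hc.ne'] at this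

open scoped Pointwise in
theorem sInf_dualValues_smul {c : ℝ} (hc : 0 < c) :
    sInf (dualValues μ ν R (c • h)) = c * sInf (dualValues μ ν R h) := by
  have : dualValues μ ν R (c • h) = c • dualValues μ ν R h := by
    ext r
    rw [Set.mem_smul_set_iff_inv_smul_mem₀ hc.ne', smul_eq_mul, ← mul_mem_dualValues_iff hc (h := h),
      mul_inv_cancel_left₀ hc.ne']
  rw [this, Real.sInf_smul_of_nonneg hc.le, smul_eq_mul]

theorem sInf_dualValues_add_le (hh : (dualValues μ ν R h).Nonempty)
    (hh' : (dualValues μ ν R h').Nonempty) :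
    sInf (dualValues μ ν R (h + h')) ≤ sInf (dualValues μ ν R h) + sInf (dualValues μ ν R h') := by
  have key : ∀ r ∈ dualValues μ ν R h, ∀ r' ∈ dualValues μ ν R h',
      sInf (dualValues μ ν R (h + h')) ≤ r + r' := fun r hr r' hr' =>
    csInf_le bddBelow_dualValues (add_mem_dualValues hr hr')
  have h1 : ∀ r ∈ dualValues μ ν R h,
      sInf (dualValues μ ν R (h + h')) - r ≤ sInf (dualValues μ ν R h') := fun r hr =>
    le_csInf hh' fun r' hr' => by linarith [key r hr r' hr']
  have h2 : sInf (dualValues μ ν R (h + h')) - sInf (dualValues μ ν R h') ≤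
      sInf (dualValues μ ν R h) := le_csInf hh fun r hr => by linarith [h1 r hr]
  linarith

end dualValues

/-- A Hahn-Banach functional on continuous functions which is dominated by the dual values and
whose total mass is the optimal one. -/
theorem exists_linearMap_le_dualValues {K : Type*} [TopologicalSpace K] [CompactSpace K]
    (μ : Measure S) (ν : Measure T) [IsFiniteMeasure μ] (R : Set (S × T)) (J : S × T → K) :
    ∃ Λ : C(K, ℝ) →ₗ[ℝ] ℝ, Λ 1 = sInf (dualValues μ ν R 1) ∧
      ∀ h : C(K, ℝ), ∀ r ∈ dualValues μ ν R (h ∘ J), Λ h ≤ r := by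
  set p : C(K, ℝ) → ℝ := fun h => sInf (dualValues μ ν R (h ∘ J)) with hp
  have hne : ∀ h : C(K, ℝ), (dualValues μ ν R (h ∘ J)).Nonempty := fun h =>
    dualValues_nonempty (C := ‖h‖) fun z => h.apply_le_norm _
  have hp0 : ∀ h, 0 ≤ p h := fun h => Real.sInf_nonneg fun r hr => nonneg_of_mem_dualValues hr
  have hsmul : ∀ c : ℝ, 0 < c → ∀ h, p (c • h) = c * p h := fun c hc h =>
    sInf_dualValues_smul (h := h ∘ J) hc
  have hadd : ∀ h h', p (h + h') ≤ p h + p h' := fun h h' =>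
    sInf_dualValues_add_le (hne h) (hne h')
  have hdom : ∃ Λ : C(K, ℝ) →ₗ[ℝ] ℝ, Λ 1 = p 1 ∧ ∀ h, Λ h ≤ p h := by
    -- Only for empty `K`. Then homogeneity gives `p 0 = 2 * p 0`, so `p 1 = p 0 = 0` and the zero
    -- functional works.
    by_cases h1 : (1 : C(K, ℝ)) = 0
    · refine ⟨0, ?_, hp0⟩
      have h2 := hsmul 2 two_pos 1
      rw [h1, smul_zero] at h2
      rw [h1]
      simp only [LinearMap.zero_apply]
      linarith
    obtain ⟨Λ, h1', h2⟩ := exists_extension_of_le_sublinear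
      (LinearPMap.mkSpanSingleton (1 : C(K, ℝ)) (p 1) h1) p hsmul hadd (by
        rintro ⟨x, hx⟩
        obtain ⟨c, rfl⟩ := Submodule.mem_span_singleton.1 hx
        have := LinearPMap.mkSpanSingleton'_apply (σ := RingHom.id ℝ) (1 : C(K, ℝ)) (p 1)
          (fun c hc => by
            rcases smul_eq_zero.1 hc with h | h
            · simp [h]
            · exact absurd h h1) c hx
        refine this.trans_le ?_
        simp only [RingHom.id_apply, smul_eq_mul]
        -- Domination on the line spanned by `1`: homogeneity for positive `c`; otherwise `c * p 1 ≤
        -- 0 ≤ p`.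
        rcases lt_or_ge 0 c with hc | hc
        · exact (hsmul c hc 1).ge
        · exact (mul_nonpos_of_nonpos_of_nonneg hc (hp0 1)).trans (hp0 _))
    refine ⟨Λ, ?_, h2⟩
    have h3 := h1' ⟨1, Submodule.mem_span_singleton_self _⟩
    rw [h3]
    exact LinearPMap.mkSpanSingleton_apply ℝ ℝ h1 (p 1)
  obtain ⟨Λ, h1, h2⟩ := hdom
  exact ⟨Λ, h1, fun h r hr => (h2 h).trans (csInf_le bddBelow_dualValues hr)⟩

/-! ### Representing the functional by a measure -/

/-- The Riesz representation of a functional on continuous functions on a compact space. -/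
theorem exists_measure_integral_eq {K : Type*} [TopologicalSpace K] [CompactSpace K] [T2Space K]
    [MeasurableSpace K] [BorelSpace K] (Λ : C(K, ℝ) →ₗ[ℝ] ℝ) (hΛ : ∀ h, 0 ≤ h → 0 ≤ Λ h) :
    ∃ α : Measure K, IsFiniteMeasure α ∧ α.Regular ∧ ∀ h : C(K, ℝ), ∫ z, h z ∂α = Λ h := by
  let Φ : CompactlySupportedContinuousMap K ℝ →ₚ[ℝ] ℝ := PositiveLinearMap.mk₀
    { toFun := fun f => Λ f.toContinuousMap
      map_add' := fun f g => Λ.map_add f.toContinuousMap g.toContinuousMap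
      map_smul' := fun c f => Λ.map_smul c f.toContinuousMap } fun f hf => hΛ _ hf
  exact ⟨RealRMK.rieszMeasure Φ, inferInstance, inferInstance, fun h =>
    RealRMK.integral_rieszMeasure Φ ⟨h, HasCompactSupport.of_compactSpace h⟩⟩

/-- Indicators of closed sets are limits of continuous functions with values in `[0, 1]`, so the
inequality holds on closed sets; inner regularity of `μ` by closed sets extends it to Borel sets. -/
theorem measure_le_of_forall_integral_le {P : Type*} [TopologicalSpace P] [HasOuterApproxClosed P]
    [MeasurableSpace P] [BorelSpace P] {μ ν : Measure P} [IsFiniteMeasure μ] [IsFiniteMeasure ν]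
    [μ.WeaklyRegular]
    (h : ∀ f : C(P, ℝ), 0 ≤ f → (∃ C, ∀ x, f x ≤ C) → ∫ x, f x ∂μ ≤ ∫ x, f x ∂ν) : μ ≤ ν := by
  have hclosed : ∀ C : Set P, IsClosed C → μ C ≤ ν C := by
    intro C hC
    refine le_of_tendsto_of_tendsto' (HasOuterApproxClosed.tendsto_lintegral_apprSeq hC μ)
      (HasOuterApproxClosed.tendsto_lintegral_apprSeq hC ν) fun n => ?_
    rw [← ENNReal.toReal_le_toReal
      (BoundedContinuousFunction.lintegral_lt_top_of_nnreal _ _).ne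
      (BoundedContinuousFunction.lintegral_lt_top_of_nnreal _ _).ne,
      BoundedContinuousFunction.toReal_lintegral_coe_eq_integral,
      BoundedContinuousFunction.toReal_lintegral_coe_eq_integral]
    exact h ⟨fun x => (hC.apprSeq n x : ℝ), by fun_prop⟩ (fun x => NNReal.coe_nonneg _)
      ⟨1, fun x => NNReal.coe_le_one.2 (HasOuterApproxClosed.apprSeq_apply_le_one hC n x)⟩
  refine Measure.le_iff.2 fun A hA => ?_
  rw [hA.measure_eq_iSup_isClosed_of_ne_top (measure_ne_top μ A)]
  exact iSup_le fun C => iSup_le fun hCA => iSup_le fun hC =>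
    (hclosed C hC).trans (measure_mono hCA)


/-- If a measure on a product has marginals dominated by the images of `μ` and `ν` under
measurable embeddings, then it is the image of a measure with marginals dominated by `μ`, `ν`. -/
theorem exists_measure_map_eq {S T P Q : Type*} [MeasurableSpace S] [MeasurableSpace T]
    [MeasurableSpace P] [MeasurableSpace Q] {μ : Measure S} {ν : Measure T} {F : S → P} {G : T → Q}
    (hF : MeasurableEmbedding F) (hG : MeasurableEmbedding G) {β : Measure (P × Q)}
    [IsFiniteMeasure β] (h₁ : β.map Prod.fst ≤ μ.map F) (h₂ : β.map Prod.snd ≤ ν.map G) :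
    ∃ α : Measure (S × T), IsFiniteMeasure α ∧ α.map Prod.fst ≤ μ ∧ α.map Prod.snd ≤ ν ∧
      α.map (Prod.map F G) = β := by
  have hJ : MeasurableEmbedding (Prod.map F G) := hF.prodMap hG
  have hmap : (β.comap (Prod.map F G)).map (Prod.map F G) = β := by
    rw [hJ.map_comap, Measure.restrict_eq_self_of_ae_mem]
    -- The dominated marginals force `β` to live on `range F × range G`, so pulling it back loses no
    -- mass.
    have e₁ : ∀ᵐ z ∂β, z.1 ∈ range F := by
      refine ae_of_ae_map measurable_fst.aemeasurable (p := fun x => x ∈ range F) ?_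
      refine (Measure.absolutelyContinuous_of_le h₁).ae_le ?_
      exact (ae_map_iff hF.measurable.aemeasurable hF.measurableSet_range).2
        (ae_of_all _ fun x => mem_range_self x)
    have e₂ : ∀ᵐ z ∂β, z.2 ∈ range G := by
      refine ae_of_ae_map measurable_snd.aemeasurable (p := fun x => x ∈ range G) ?_
      refine (Measure.absolutelyContinuous_of_le h₂).ae_le ?_
      exact (ae_map_iff hG.measurable.aemeasurable hG.measurableSet_range).2
        (ae_of_all _ fun x => mem_range_self x)
    filter_upwards [e₁, e₂] with z hz₁ hz₂
    rw [range_prodMap]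
    exact ⟨hz₁, hz₂⟩
  have hfin : IsFiniteMeasure (β.comap (Prod.map F G)) := by
    refine ⟨?_⟩
    have := measure_lt_top ((β.comap (Prod.map F G)).map (Prod.map F G)) univ
    rwa [Measure.map_apply hJ.measurable MeasurableSet.univ, preimage_univ] at this
  refine ⟨β.comap (Prod.map F G), hfin, ?_, ?_, hmap⟩
  · have h : ((β.comap (Prod.map F G)).map Prod.fst).map F ≤ μ.map F := by
      rw [Measure.map_map hF.measurable measurable_fst]
      change (β.comap (Prod.map F G)).map (Prod.fst ∘ Prod.map F G) ≤ _
      rw [← Measure.map_map measurable_fst hJ.measurable, hmap]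
      exact h₁
    refine Measure.le_iff.2 fun A _ => ?_
    have := h (F '' A)
    rwa [hF.map_apply, hF.map_apply, hF.injective.preimage_image] at this
  · have h : ((β.comap (Prod.map F G)).map Prod.snd).map G ≤ ν.map G := by
      rw [Measure.map_map hG.measurable measurable_snd]
      change (β.comap (Prod.map F G)).map (Prod.snd ∘ Prod.map F G) ≤ _
      rw [← Measure.map_map measurable_snd hJ.measurable, hmap]
      exact h₂
    refine Measure.le_iff.2 fun A _ => ?_
    have := h (G '' A)
    rwa [hG.map_apply, hG.map_apply, hG.injective.preimage_image] at this

/-- A closed relation between Polish spaces carries a measure with marginals dominated by `μ`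
and `ν` whose mass is the infimum of the dual problem. -/
theorem exists_measure_dominated_marginals {S T : Type*} [MetricSpace S] [CompleteSpace S]
    [SecondCountableTopology S] [MeasurableSpace S] [BorelSpace S] [MetricSpace T] [CompleteSpace T]
    [SecondCountableTopology T] [MeasurableSpace T] [BorelSpace T] (μ : Measure S) (ν : Measure T)
    [IsFiniteMeasure μ] [IsFiniteMeasure ν] {R : Set (S × T)} (hR : IsClosed R) :
    ∃ α : Measure (S × T), IsFiniteMeasure α ∧ α.map Prod.fst ≤ μ ∧ α.map Prod.snd ≤ ν ∧
      α Rᶜ = 0 ∧ α.real univ = sInf (dualValues μ ν R 1) := by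
  -- Hilbert cubes supply the compactness that the Riesz theorem needs; continuous injections of
  -- Polish spaces are measurable embeddings, so measures can be pulled back.
  obtain ⟨F, hF⟩ := Metric.PiNatEmbed.exists_embedding_to_hilbert_cube (X := S)
  obtain ⟨G, hG⟩ := Metric.PiNatEmbed.exists_embedding_to_hilbert_cube (X := T)
  have mF := hF.continuous.measurableEmbedding hF.injective
  have mG := hG.continuous.measurableEmbedding hG.injective
  obtain ⟨Λ, hΛ1, hΛ⟩ := exists_linearMap_le_dualValues μ ν R (Prod.map F G)
  have hdual : ∀ (h : C((ℕ → unitInterval) × (ℕ → unitInterval), ℝ)) (u : S → ℝ) (v : T → ℝ),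
      Measurable u → Measurable v → Integrable u μ → Integrable v ν → 0 ≤ u → 0 ≤ v →
      (∀ z ∈ R, h (F z.1, G z.2) ≤ u z.1 + v z.2) → Λ h ≤ ∫ x, u x ∂μ + ∫ y, v y ∂ν :=
    fun h u v hu hv iu iv pu pv hle => hΛ h _ ⟨u, v, hu, hv, iu, iv, pu, pv, hle, rfl⟩
  -- The dual pair `u = v = 0`. Applied to `-h` it gives positivity of `Λ`; applied to functions
  -- vanishing on `R` it will give the support property.
  have hzero : ∀ h : C((ℕ → unitInterval) × (ℕ → unitInterval), ℝ),
      (∀ z ∈ R, h (F z.1, G z.2) ≤ 0) → Λ h ≤ 0 := fun h hle => by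
    simpa using hdual h 0 0 measurable_zero measurable_zero (integrable_zero _ _ _)
      (integrable_zero _ _ _) le_rfl le_rfl (by simpa using hle)
  have hpos : ∀ h, 0 ≤ h → 0 ≤ Λ h := fun h hh => by
    have := hzero (-h) fun z _ => neg_nonpos.2 (hh _)
    rw [map_neg] at this
    linarith
  obtain ⟨β, hβ, hβr, hint⟩ := exists_measure_integral_eq Λ hpos
  have h₁ : β.map Prod.fst ≤ μ.map F := by
    refine measure_le_of_forall_integral_le fun f hf ⟨C, hC⟩ => ?_
    rw [integral_map measurable_fst.aemeasurable f.continuous.aestronglyMeasurable,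
      integral_map mF.measurable.aemeasurable f.continuous.aestronglyMeasurable]
    have := hdual (f.comp ⟨Prod.fst, continuous_fst⟩) (f ∘ F) 0
      (f.continuous.measurable.comp mF.measurable) measurable_zero
      (Integrable.of_bound (f.continuous.comp hF.continuous).aestronglyMeasurable C
        (ae_of_all _ fun x => (Real.norm_of_nonneg (hf (F x))).trans_le (hC _)))
      (integrable_zero _ _ _) (fun x => hf _) le_rfl (by simp)
    rw [← hint] at this
    simpa using this
  have h₂ : β.map Prod.snd ≤ ν.map G := by
    refine measure_le_of_forall_integral_le fun f hf ⟨C, hC⟩ => ?_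
    rw [integral_map measurable_snd.aemeasurable f.continuous.aestronglyMeasurable,
      integral_map mG.measurable.aemeasurable f.continuous.aestronglyMeasurable]
    have := hdual (f.comp ⟨Prod.snd, continuous_snd⟩) 0 (f ∘ G)
      measurable_zero (f.continuous.measurable.comp mG.measurable) (integrable_zero _ _ _)
      (Integrable.of_bound (f.continuous.comp hG.continuous).aestronglyMeasurable C
        (ae_of_all _ fun x => (Real.norm_of_nonneg (hf (G x))).trans_le (hC _)))
      le_rfl (fun x => hf _) (by simp)
    rw [← hint] at this
    simpa using this
  obtain ⟨α, hα, hα₁, hα₂, hmap⟩ := exists_measure_map_eq mF mG h₁ h₂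
  have mJ : MeasurableEmbedding (Prod.map F G) := mF.prodMap mG
  refine ⟨α, hα, hα₁, hα₂, ?_, ?_⟩
  -- `W` is open in the compact product and has trace `Rᶜ`. A Urysohn function that is `1` on a
  -- compact `C ⊆ W` and `0` off `W` vanishes on `R`, so `β C ≤ Λ f ≤ 0`; regularity then gives `β W
  -- = 0`.
  · obtain ⟨W, hW, hWR⟩ := ((hF.prodMap hG).isInducing.isOpen_iff).1 hR.isOpen_compl
    have hβW : β W = 0 := by
      rw [hW.measure_eq_iSup_isCompact]
      simp only [ENNReal.iSup_eq_zero]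
      intro C hCW hC
      obtain ⟨f, hf0, hf1, hf01⟩ := exists_continuous_zero_one_of_isClosed hW.isClosed_compl
        hC.isClosed (disjoint_compl_left_iff_subset.2 hCW)
      have hle : Λ f ≤ 0 := hzero f fun z hz => by
        refine (hf0 (x := (F z.1, G z.2)) fun hzW => ?_).le
        have : z ∈ Rᶜ := by
          rw [← hWR]
          exact hzW
        exact this hz
      have hC1 : β.real C ≤ ∫ z, f z ∂β := by
        rw [← integral_indicator_one hC.measurableSet]
        refine integral_mono ((integrable_const _).indicator hC.measurableSet)
          (Integrable.of_bound f.continuous.aestronglyMeasurable 1 (ae_of_all _ fun x => ?_))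
          fun x => ?_
        · rw [Real.norm_of_nonneg (hf01 x).1]
          exact (hf01 x).2
        · by_cases hx : x ∈ C
          · simp [hx, hf1 hx]
          · simpa [hx] using (hf01 x).1
      rw [hint] at hC1
      exact (measureReal_eq_zero_iff).1 (le_antisymm (hC1.trans hle) measureReal_nonneg)
    rw [← hWR, ← Measure.map_apply mJ.measurable hW.measurableSet, hmap]
    exact hβW
  · have : α.real univ = β.real univ := by
      rw [← hmap, map_measureReal_apply mJ.measurable MeasurableSet.univ, preimage_univ]
    rw [this, ← hΛ1, ← hint]
    simp


/-- Layer-cake form of the Hall condition: an inequality between measures of compact sets and of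
their images under `R` bounds the values of the dual problem from below. -/
theorem measureReal_univ_le_of_forall_isCompact {S T : Type*} [TopologicalSpace S]
    [MeasurableSpace S] [MeasurableSpace T] {μ : Measure S} {ν : Measure T}
    [IsFiniteMeasure μ] [μ.InnerRegularCompactLTTop] {R : Set (S × T)} {ε : ℝ≥0}
    (H : ∀ B : Set S, IsCompact B → μ B ≤ ν {y | ∃ x ∈ B, (x, y) ∈ R} + ε)
    {u : S → ℝ} {v : T → ℝ} (hu : Measurable u) (hv : Measurable v) (iu : Integrable u μ)
    (iv : Integrable v ν) (pv : 0 ≤ v) (hle : ∀ z ∈ R, 1 ≤ u z.1 + v z.2) (pu : 0 ≤ u) :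
    μ.real univ ≤ ∫ x, u x ∂μ + ∫ y, v y ∂ν + ε := by
  set w : S → ℝ := fun x => max (1 - u x) 0 with hw
  have mw : Measurable w := (measurable_const.sub hu).max measurable_const
  have pw : 0 ≤ w := fun x => le_max_right _ _
  have iw : Integrable w μ := ((integrable_const 1).sub iu).sup (integrable_zero _ _ _)
  -- On `R` one has `1 - u ≤ v`, so `R` carries `{t ≤ w}` into `{t ≤ v}`. Since `w ≤ 1`, the error
  -- `ε` is needed only for `t ∈ (0, 1]`, and integrates to exactly `ε`.
  have hlevel : ∀ t ∈ Ioi (0 : ℝ), μ {x | t ≤ w x} ≤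
      ν {y | t ≤ v y} + (Iic 1).indicator (fun _ => (ε : ℝ≥0∞)) t := by
    intro t ht
    rcases le_or_gt t 1 with ht1 | ht1
    · rw [indicator_of_mem (mem_Iic.2 ht1)]
      rw [(measurableSet_le measurable_const mw).measure_eq_iSup_isCompact_of_ne_top
        (measure_ne_top μ _)]
      refine iSup_le fun B => iSup_le fun hB => iSup_le fun hBc => (H B hBc).trans ?_
      refine add_le_add (measure_mono ?_) le_rfl
      rintro y ⟨x, hx, hxy⟩
      refine (hB hx).trans (max_le ?_ (pv y))
      linarith [hle _ hxy]
    · have : {x | t ≤ w x} = ∅ := by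
        refine eq_empty_of_forall_notMem fun x hx => ?_
        have h1 : w x ≤ 1 := max_le (sub_le_self _ (pu x)) zero_le_one
        exact absurd (ht1.trans_le (hx.trans h1)) (lt_irrefl _)
      simp [this]
  have hlint : ∫⁻ x, ENNReal.ofReal (w x) ∂μ ≤ ∫⁻ y, ENNReal.ofReal (v y) ∂ν + ε := by
    rw [lintegral_eq_lintegral_meas_le μ (ae_of_all _ pw) mw.aemeasurable,
      lintegral_eq_lintegral_meas_le ν (ae_of_all _ pv) hv.aemeasurable]
    refine (setLIntegral_mono' measurableSet_Ioi hlevel).trans ?_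
    rw [lintegral_add_right _ (measurable_const.indicator measurableSet_Iic),
      lintegral_indicator measurableSet_Iic, Measure.restrict_restrict measurableSet_Iic]
    rw [inter_comm, Ioi_inter_Iic]
    simp
  rw [← ofReal_integral_eq_lintegral_ofReal iw (ae_of_all _ pw),
    ← ofReal_integral_eq_lintegral_ofReal iv (ae_of_all _ pv), ← ENNReal.ofReal_coe_nnreal,
    ← ENNReal.ofReal_add (integral_nonneg pv) ε.coe_nonneg,
    ENNReal.ofReal_le_ofReal_iff (add_nonneg (integral_nonneg pv) ε.coe_nonneg)] at hlint
  have h1 : ∫ x, (1 - u x) ∂μ ≤ ∫ x, w x ∂μ :=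
    integral_mono ((integrable_const 1).sub iu) iw fun x => le_max_left _ _
  rw [integral_sub (integrable_const 1) iu] at h1
  simp only [integral_const, smul_eq_mul, mul_one] at h1
  linarith

/-- **Strassen's theorem** for finite measures and a closed relation between Polish spaces. -/
theorem exists_measure_of_forall_isCompact {S T : Type*} [MetricSpace S] [CompleteSpace S]
    [SecondCountableTopology S] [MeasurableSpace S] [BorelSpace S] [MetricSpace T] [CompleteSpace T]
    [SecondCountableTopology T] [MeasurableSpace T] [BorelSpace T] (μ : Measure S) (ν : Measure T)
    [IsFiniteMeasure μ] [IsFiniteMeasure ν] {R : Set (S × T)} (hR : IsClosed R) {ε : ℝ≥0}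
    (h₁ : ∀ B : Set S, IsCompact B → μ B ≤ ν {y | ∃ x ∈ B, (x, y) ∈ R} + ε)
    (h₂ : ∀ C : Set T, IsCompact C → ν C ≤ μ {x | ∃ y ∈ C, (x, y) ∈ R} + ε) :
    ∃ α : Measure (S × T), IsFiniteMeasure α ∧ α.map Prod.fst ≤ μ ∧ α.map Prod.snd ≤ ν ∧
      α Rᶜ = 0 ∧ μ univ ≤ α univ + ε ∧ ν univ ≤ α univ + ε := by
  obtain ⟨α, hα, hα₁, hα₂, hαR, hmass⟩ := exists_measure_dominated_marginals μ ν hR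
  have hne : (dualValues μ ν R 1).Nonempty := dualValues_nonempty (C := 1) fun _ => le_rfl
  have key : ∀ r : ℝ≥0∞, r ≠ ∞ → r.toReal - ε ≤ α.real univ → r ≤ α univ + ε := by
    intro r hr h
    rw [← ENNReal.toReal_le_toReal hr (by finiteness),
      ENNReal.toReal_add (measure_ne_top _ _) ENNReal.coe_ne_top]
    change r.toReal ≤ α.real univ + ε
    linarith
  refine ⟨α, hα, hα₁, hα₂, hαR, key _ (measure_ne_top μ univ) ?_,
    key _ (measure_ne_top ν univ) ?_⟩
  · rw [hmass]
    refine le_csInf hne ?_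
    rintro _ ⟨u, v, hu, hv, iu, iv, pu, pv, hle, rfl⟩
    have := measureReal_univ_le_of_forall_isCompact h₁ hu hv iu iv pv hle pu
    rw [Measure.real] at this
    linarith
  · rw [hmass]
    refine le_csInf hne ?_
    rintro _ ⟨u, v, hu, hv, iu, iv, pu, pv, hle, rfl⟩
    have := measureReal_univ_le_of_forall_isCompact (R := Prod.swap ⁻¹' R) h₂ hv hu iv iu pu
      (fun z hz => by
        have := hle _ hz
        rw [add_comm]
        exact this) pv
    rw [Measure.real] at this
    linarith

/-! ### Completing a partial coupling -/

theorem tvDist_add_measure_univ_le {S : Type u} [MeasurableSpace S] {κ μ : Measure S}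
    [IsFiniteMeasure μ] (h : κ ≤ μ) : tvDist κ μ + κ univ ≤ μ univ := by
  have : IsFiniteMeasure κ := isFiniteMeasure_of_le μ h
  rw [← ENNReal.le_sub_iff_add_le_right (measure_ne_top κ univ) (h univ)]
  refine iSup_le fun A => iSup_le fun hA => ?_
  -- The deficit `μ - κ` is nonnegative on both `A` and `Aᶜ`, so on `A` it is at most the total
  -- deficit.
  have hA' := measureReal_compl hA (μ := κ)
  have hA'' := measureReal_compl hA (μ := μ)
  have h1 : κ.real A ≤ μ.real A := ENNReal.toReal_mono (measure_ne_top _ _) (h A)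
  have h2 : κ.real Aᶜ ≤ μ.real Aᶜ := ENNReal.toReal_mono (measure_ne_top _ _) (h Aᶜ)
  rw [abs_of_nonpos (by linarith)]
  refine ENNReal.ofReal_le_of_le_toReal ?_
  rw [ENNReal.toReal_sub_of_le (h univ) (measure_ne_top _ _)]
  change _ ≤ μ.real univ - κ.real univ
  linarith

/-- A measure carried by `R` with dominated marginals is completed by a multiple of the product of
the two residual measures. -/
theorem exists_discrepancy_add_le {S T : Type u} [MeasurableSpace S] [MeasurableSpace T]
    {μ : Measure S} {ν : Measure T} [IsFiniteMeasure μ] [IsFiniteMeasure ν] {R : Set (S × T)}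
    {ε : ℝ≥0} {α : Measure (S × T)} [IsFiniteMeasure α] (h₁ : α.map Prod.fst ≤ μ)
    (h₂ : α.map Prod.snd ≤ ν) (hR : α Rᶜ = 0) (hμ : μ univ ≤ α univ + ε)
    (hν : ν univ ≤ α univ + ε) :
    ∃ β : Measure (S × T), IsFiniteMeasure β ∧ discrepancy β μ ν + β Rᶜ ≤ ε := by
  set ρ₁ := μ - α.map Prod.fst with hρ₁
  set ρ₂ := ν - α.map Prod.snd with hρ₂
  have e₁ : ρ₁ + α.map Prod.fst = μ := Measure.sub_add_cancel_of_le h₁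
  have e₂ : ρ₂ + α.map Prod.snd = ν := Measure.sub_add_cancel_of_le h₂
  have f₁ : IsFiniteMeasure ρ₁ := isFiniteMeasure_of_le μ Measure.sub_le
  have f₂ : IsFiniteMeasure ρ₂ := isFiniteMeasure_of_le ν Measure.sub_le
  have m₁ : α.map Prod.fst univ = α univ := by
    rw [Measure.map_apply measurable_fst MeasurableSet.univ, preimage_univ]
  have m₂ : α.map Prod.snd univ = α univ := by
    rw [Measure.map_apply measurable_snd MeasurableSet.univ, preimage_univ]
  have u₁ : ρ₁ univ + α univ = μ univ := by
    rw [← m₁, ← Measure.add_apply, e₁]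
  have u₂ : ρ₂ univ + α univ = ν univ := by
    rw [← m₂, ← Measure.add_apply, e₂]
  rw [← u₁, add_comm, ENNReal.add_le_add_iff_left (measure_ne_top _ _)] at hμ
  rw [← u₂, add_comm, ENNReal.add_le_add_iff_left (measure_ne_top _ _)] at hν
  -- Take `c` to be the inverse of the larger residual mass: the marginals of `c • ρ₁.prod ρ₂` stay
  -- below `ρ₁` and `ρ₂`, and its mass is the smaller residual mass.
  obtain ⟨c, hc, hc₁, hc₂, hmin⟩ : ∃ c : ℝ≥0∞, c ≠ ∞ ∧ c * ρ₁ univ ≤ 1 ∧ c * ρ₂ univ ≤ 1 ∧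
      min (ρ₁ univ) (ρ₂ univ) ≤ c * (ρ₁ univ * ρ₂ univ) := by
    by_cases h0 : max (ρ₁ univ) (ρ₂ univ) = 0
    · refine ⟨0, ENNReal.zero_ne_top, by simp, by simp, ?_⟩
      rw [← nonpos_iff_eq_zero, max_le_iff] at h0
      exact (min_le_left _ _).trans (h0.1.trans zero_le)
    · have ht : max (ρ₁ univ) (ρ₂ univ) ≠ ∞ := by finiteness
      refine ⟨(max (ρ₁ univ) (ρ₂ univ))⁻¹, ENNReal.inv_ne_top.2 h0, ?_, ?_, ?_⟩
      · exact (mul_le_mul_right (le_max_left _ _) _).trans (ENNReal.inv_mul_le_one _)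
      · exact (mul_le_mul_right (le_max_right _ _) _).trans (ENNReal.inv_mul_le_one _)
      · rw [← max_mul_min (ρ₁ univ), ← mul_assoc, ENNReal.inv_mul_cancel h0 ht, one_mul]
  set β := α + c • ρ₁.prod ρ₂ with hβ
  have fβ : IsFiniteMeasure β := by
    have : IsFiniteMeasure (c • ρ₁.prod ρ₂) := Measure.smul_finite _ hc
    infer_instance
  have b₁ : β.map Prod.fst ≤ μ := by
    rw [hβ, Measure.map_add _ _ measurable_fst, Measure.map_smul, Measure.map_fst_prod, smul_smul,
      ← e₁, add_comm]
    gcongr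
    exact (Measure.le_iff.2 fun A _ => by
      simpa using mul_le_mul_left hc₂ (ρ₁ A))
  have b₂ : β.map Prod.snd ≤ ν := by
    rw [hβ, Measure.map_add _ _ measurable_snd, Measure.map_smul, Measure.map_snd_prod, smul_smul,
      ← e₂, add_comm]
    gcongr
    exact (Measure.le_iff.2 fun A _ => by
      simpa using mul_le_mul_left hc₁ (ρ₂ A))
  have t₁ := tvDist_add_measure_univ_le b₁
  have t₂ := tvDist_add_measure_univ_le b₂
  rw [Measure.map_apply measurable_fst MeasurableSet.univ, preimage_univ, ← u₁] at t₁
  rw [Measure.map_apply measurable_snd MeasurableSet.univ, preimage_univ, ← u₂] at t₂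
  have uβ : β univ = α univ + c * (ρ₁ univ * ρ₂ univ) := by
    rw [hβ, Measure.add_apply, Measure.smul_apply, ← univ_prod_univ, Measure.prod_prod, smul_eq_mul]
  have cβ : β Rᶜ ≤ c * (ρ₁ univ * ρ₂ univ) := by
    rw [hβ, Measure.add_apply, hR, zero_add, Measure.smul_apply, smul_eq_mul, ← Measure.prod_prod,
      univ_prod_univ]
    gcongr
    exact subset_univ _
  have hq : c * (ρ₁ univ * ρ₂ univ) ≠ ∞ := by finiteness
  refine ⟨β, fβ, ?_⟩
  rw [discrepancy]
  rw [uβ] at t₁ t₂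
  have d₁ : tvDist (β.map Prod.fst) μ ≠ ∞ :=
    ne_top_of_le_ne_top (by finiteness) (le_self_add.trans t₁)
  have d₂ : tvDist (β.map Prod.snd) ν ≠ ∞ :=
    ne_top_of_le_ne_top (by finiteness) (le_self_add.trans t₂)
  have fa := measure_ne_top α univ
  have fr₁ := measure_ne_top ρ₁ univ
  have fr₂ := measure_ne_top ρ₂ univ
  have fb := measure_ne_top β Rᶜ
  generalize c * (ρ₁ univ * ρ₂ univ) = q at *
  generalize tvDist (β.map Prod.fst) μ = D₁ at *
  generalize tvDist (β.map Prod.snd) ν = D₂ at *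
  generalize α univ = a at *
  generalize ρ₁ univ = r₁ at *
  generalize ρ₂ univ = r₂ at *
  generalize β Rᶜ = b at *
  lift q to ℝ≥0 using hq
  lift D₁ to ℝ≥0 using d₁
  lift D₂ to ℝ≥0 using d₂
  lift a to ℝ≥0 using fa
  lift r₁ to ℝ≥0 using fr₁
  lift r₂ to ℝ≥0 using fr₂
  lift b to ℝ≥0 using fb
  norm_cast at *
  -- With `D₁ ≤ r₁ - q`, `D₂ ≤ r₂ - q` and `b ≤ q`, the total is at most `r₁ + r₂ - q`. As `q` is at
  -- least one of the residual masses, this is at most the other, hence at most `ε`.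
  rcases min_le_iff.1 hmin with h | h <;>
  · rw [← NNReal.coe_le_coe] at *
    push_cast at *
    linarith

end Strassen

/-! ### From correspondences to embeddings -/

section Correspondence

theorem Marked.dist_map_le_iff {X Y Z : Type u} [MetricSpace Z] {k : ℕ} {Ξ : Type u}
    [MetricSpace Ξ] {f : X → Z} {g : Y → Z} {r : ℝ} (hr : 0 ≤ r) (p : Marked k X Ξ)
    (q : Marked k Y Ξ) :
    dist (Marked.map f p) (Marked.map g q) ≤ r ↔
      (∀ j, dist (f (p.1 j)) (g (q.1 j)) ≤ r) ∧ dist p.2 q.2 ≤ r := by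
  rw [← dist_pi_le_iff (f := fun j => f (p.1 j)) (g := fun j => g (q.1 j)) hr]
  exact max_le_iff

variable {X Y Z : Type u} [MetricSpace X] [MetricSpace Y] [MetricSpace Z]

/-! ### From compatibility to distances of structures -/

theorem measure_le_add_tvDist {S : Type u} [MeasurableSpace S] (μ ν : Measure S)
    [IsFiniteMeasure μ] [IsFiniteMeasure ν] {A : Set S} (hA : MeasurableSet A) :
    μ A ≤ ν A + tvDist μ ν := by
  have h : ENNReal.ofReal |μ.real A - ν.real A| ≤ tvDist μ ν :=
    le_iSup₂ (f := fun (A : Set S) (_ : MeasurableSet A) =>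
      ENNReal.ofReal |μ.real A - ν.real A|) A hA
  refine le_trans ?_ (add_le_add le_rfl h)
  rw [← ofReal_measureReal (measure_ne_top μ A), ← ofReal_measureReal (measure_ne_top ν A),
    ← ENNReal.ofReal_add measureReal_nonneg (abs_nonneg _)]
  exact ENNReal.ofReal_le_ofReal (by linarith [le_abs_self (μ.real A - ν.real A)])

theorem tvDist_comm {S : Type u} [MeasurableSpace S] (μ ν : Measure S) :
    tvDist μ ν = tvDist ν μ := by
  simp only [tvDist, abs_sub_comm]

/-- Pass from `μ` to the first marginal, move along `R` at cost `α Rᶜ`, and pass from the second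
marginal to `ν`. Only monotonicity and subadditivity of `α` are used at `R`, so `R` need not be
measurable. -/
theorem measure_le_add_discrepancy {S T : Type u} [MeasurableSpace S] [MeasurableSpace T]
    {α : Measure (S × T)} [IsFiniteMeasure α] {μ : Measure S} {ν : Measure T} [IsFiniteMeasure μ]
    [IsFiniteMeasure ν] {R : Set (S × T)} {A : Set S} {C : Set T} (hA : MeasurableSet A)
    (hC : MeasurableSet C) (h : ∀ z ∈ R, z.1 ∈ A → z.2 ∈ C) :
    μ A ≤ ν C + (discrepancy α μ ν + α Rᶜ) := by
  have h₁ := measure_le_add_tvDist μ (α.map Prod.fst) hA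
  have h₂ := measure_le_add_tvDist (α.map Prod.snd) ν hC
  rw [Measure.map_apply measurable_fst hA, tvDist_comm] at h₁
  rw [Measure.map_apply measurable_snd hC] at h₂
  have h₃ : α (Prod.fst ⁻¹' A) ≤ α (Prod.snd ⁻¹' C) + α Rᶜ :=
    (measure_mono fun z hz => by
      by_cases hzR : z ∈ R
      · exact Or.inl (h z hzR hz)
      · exact Or.inr hzR).trans (measure_union_le _ _)
  calc μ A ≤ ν C + tvDist (α.map Prod.snd) ν + α Rᶜ + tvDist (α.map Prod.fst) μ :=
        h₁.trans (add_le_add (h₃.trans (add_le_add h₂ le_rfl)) le_rfl)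
    _ = _ := by
        rw [discrepancy]
        ring

theorem measure_le_add_discrepancy' {S T : Type u} [MeasurableSpace S] [MeasurableSpace T]
    {α : Measure (S × T)} [IsFiniteMeasure α] {μ : Measure S} {ν : Measure T} [IsFiniteMeasure μ]
    [IsFiniteMeasure ν] {R : Set (S × T)} {A : Set S} {C : Set T} (hA : MeasurableSet A)
    (hC : MeasurableSet C) (h : ∀ z ∈ R, z.2 ∈ C → z.1 ∈ A) :
    ν C ≤ μ A + (discrepancy α μ ν + α Rᶜ) := by
  have h₁ := measure_le_add_tvDist (α.map Prod.fst) μ hA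
  have h₂ := measure_le_add_tvDist ν (α.map Prod.snd) hC
  rw [Measure.map_apply measurable_fst hA] at h₁
  rw [Measure.map_apply measurable_snd hC, tvDist_comm] at h₂
  have h₃ : α (Prod.snd ⁻¹' C) ≤ α (Prod.fst ⁻¹' A) + α Rᶜ :=
    (measure_mono fun z hz => by
      by_cases hzR : z ∈ R
      · exact Or.inl (h z hzR hz)
      · exact Or.inr hzR).trans (measure_union_le _ _)
  calc ν C ≤ μ A + tvDist (α.map Prod.fst) μ + α Rᶜ + tvDist (α.map Prod.snd) ν :=
        h₂.trans (add_le_add (h₃.trans (add_le_add h₁ le_rfl)) le_rfl)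
    _ = _ := by
        rw [discrepancy]
        ring

theorem Kind.Compatible.strDist_push_le {R : Set (X × Y)} {ε : ℝ≥0} {f : X → Z} {g : Y → Z}
    (hf : Isometry f) (hg : Isometry g) (hR : ∀ z ∈ R, dist (f z.1) (g z.2) ≤ ε)
    {κ : Kind.{u}} {a : κ.Str X} {b : κ.Str Y} (h : κ.Compatible R ε a b) :
    κ.strDist (κ.push f hf a) (κ.push g hg b) ≤ ε := by
  have hmarked : ∀ (k : ℕ) (Ξ : MarkSpace.{u}), ∀ z ∈ markedRel R k Ξ ε,
      dist (Marked.map f z.1) (Marked.map g z.2) ≤ ε := fun k Ξ z hz =>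
    (Marked.dist_map_le_iff ε.coe_nonneg _ _).2 ⟨fun j => hR _ (hz.1 j), hz.2⟩
  have hedist : ∀ {W : Type u} [MetricSpace W] {x y : W}, dist x y ≤ ε → edist x y ≤ ε :=
    fun {W} _ {x y} hxy => by
      rw [edist_dist]
      exact ENNReal.ofReal_le_of_le_toReal (by simpa using hxy)
  cases κ with
  | measure k Ξ =>
    change FiniteMeasure (Marked k X Ξ) at a
    change FiniteMeasure (Marked k Y Ξ) at b
    obtain ⟨α, hα, hle⟩ := h
    have mf := (Marked.continuous_map (k := k) (Ξ := Ξ) hf).measurable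
    have mg := (Marked.continuous_map (k := k) (Ξ := Ξ) hg).measurable
    change levyProkhorovEDist ((a : Measure (Marked k X Ξ)).map (Marked.map f))
      ((b : Measure (Marked k Y Ξ)).map (Marked.map g)) ≤ ε
    -- Testing at `δ > ε` turns the bound `≤ ε` on distances into membership in the open
    -- `δ`-thickening.
    refine levyProkhorovEDist_le_of_forall _ _ _ fun δ B hδ hδ' hB => ?_
    have hthick : MeasurableSet (Metric.thickening δ.toReal B) :=
      Metric.isOpen_thickening.measurableSet
    have hεδ : (ε : ℝ) < δ.toReal := by
      simpa using (ENNReal.toReal_lt_toReal ENNReal.coe_ne_top hδ'.ne).2 hδ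
    rw [Measure.map_apply mf hB, Measure.map_apply mg hB, Measure.map_apply mf hthick,
      Measure.map_apply mg hthick]
    constructor
    · refine (measure_le_add_discrepancy (mf hB) (mg hthick) fun z hz hzB => ?_).trans
        (add_le_add le_rfl (hle.trans hδ.le))
      refine Metric.mem_thickening_iff.2 ⟨_, hzB, ?_⟩
      rw [dist_comm]
      exact (hmarked k Ξ z hz).trans_lt hεδ
    · refine (measure_le_add_discrepancy' (mf hthick) (mg hB) fun z hz hzB => ?_).trans
        (add_le_add le_rfl (hle.trans hδ.le))
      exact Metric.mem_thickening_iff.2 ⟨_, hzB, (hmarked k Ξ z hz).trans_lt hεδ⟩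
  | compact k Ξ =>
    change TopologicalSpace.Compacts (Marked k X Ξ) at a
    change TopologicalSpace.Compacts (Marked k Y Ξ) at b
    change Metric.hausdorffEDist (Marked.map f '' (a : Set (Marked k X Ξ)))
      (Marked.map g '' (b : Set (Marked k Y Ξ))) ≤ ε
    refine Metric.hausdorffEDist_le_of_mem_edist ?_ ?_
    · rintro _ ⟨p, hp, rfl⟩
      obtain ⟨q, hq, hpq⟩ := h.1 p hp
      exact ⟨_, mem_image_of_mem _ hq, hedist (hmarked k Ξ _ hpq)⟩
    · rintro _ ⟨q, hq, rfl⟩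
      obtain ⟨p, hp, hpq⟩ := h.2 q hq
      refine ⟨_, mem_image_of_mem _ hp, ?_⟩
      rw [edist_comm]
      exact hedist (hmarked k Ξ _ hpq)
  | curve => exact iSup_le fun t => hedist (hR _ (h t))

theorem Kind.Compatible.mono {R : Set (X × Y)} {ε δ : ℝ≥0} (hεδ : ε ≤ δ) {κ : Kind.{u}}
    {a : κ.Str X} {b : κ.Str Y} (h : κ.Compatible R ε a b) : κ.Compatible R δ a b := by
  have hsub : ∀ (k : ℕ) (Ξ : MarkSpace.{u}), markedRel R k Ξ ε ⊆ markedRel R k Ξ δ :=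
    fun k Ξ z hz => ⟨hz.1, hz.2.trans (NNReal.coe_le_coe.2 hεδ)⟩
  cases κ with
  | measure k Ξ =>
    obtain ⟨α, hα, hle⟩ := h
    exact ⟨α, hα, (add_le_add le_rfl (measure_mono (compl_subset_compl.2 (hsub k Ξ)))).trans
      (hle.trans (ENNReal.coe_le_coe.2 hεδ))⟩
  | compact k Ξ =>
    exact ⟨fun p hp => (h.1 p hp).imp fun q hq => ⟨hq.1, hsub k Ξ hq.2⟩,
      fun q hq => (h.2 q hq).imp fun p hp => ⟨hp.1, hsub k Ξ hp.2⟩⟩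
  | curve => exact h

/-! ### Gluing along a correspondence -/

theorem abs_dist_sub_dist_le_of_distortion_le {R : Set (X × Y)} {ε : ℝ≥0}
    (h : distortion R ≤ 2 * ε) {p q : X × Y} (hp : p ∈ R) (hq : q ∈ R) :
    |dist p.1 q.1 - dist p.2 q.2| ≤ 2 * ε := by
  have h1 : ENNReal.ofReal |dist p.1 q.1 - dist p.2 q.2| ≤ 2 * ε :=
    (le_iSup₂_of_le (f := fun (p : X × Y) (_ : p ∈ R) =>
      ⨆ q ∈ R, ENNReal.ofReal |dist p.1 q.1 - dist p.2 q.2|) p hp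
      (le_iSup₂_of_le (f := fun (q : X × Y) (_ : q ∈ R) =>
        ENNReal.ofReal |dist p.1 q.1 - dist p.2 q.2|) q hq le_rfl)).trans h
  rw [ENNReal.ofReal_le_iff_le_toReal (by finiteness)] at h1
  simpa using h1

/-- Gluing along a correspondence. -/
theorem exists_isometry_dist_le [CompactSpace X] [CompactSpace Y] {R : Set (X × Y)}
    (hR : IsCorrespondence R) {ε : ℝ} (hε : 0 < ε)
    (hdis : ∀ p ∈ R, ∀ q ∈ R, |dist p.1 q.1 - dist p.2 q.2| ≤ 2 * ε) :
    ∃ (W : Type u) (_ : MetricSpace W) (_ : CompactSpace W) (f : X → W) (g : Y → W),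
      Isometry f ∧ Isometry g ∧ ∀ z ∈ R, dist (f z.1) (g z.2) ≤ ε := by
  -- The glued metric is an infimum over `R`, so `R` must be nonempty; an empty correspondence means
  -- that both spaces are empty.
  rcases R.eq_empty_or_nonempty with rfl | hne
  · have hX : IsEmpty X := by
      have := hR.1
      rw [image_empty] at this
      exact univ_eq_empty_iff.1 this.symm
    have hY : IsEmpty Y := by
      have := hR.2
      rw [image_empty] at this
      exact univ_eq_empty_iff.1 this.symm
    exact ⟨PUnit, inferInstance, inferInstance, isEmptyElim, isEmptyElim, fun x => isEmptyElim x,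
      fun y => isEmptyElim y, fun z hz => absurd hz (notMem_empty z)⟩
  have : Nonempty R := hne.to_subtype
  let _ : MetricSpace (X ⊕ Y) := Metric.glueMetricApprox (fun z : R => z.1.1) (fun z : R => z.1.2) ε
    hε fun p q => hdis p p.2 q q.2
  have hl : Isometry (Sum.inl : X → X ⊕ Y) := Isometry.of_dist_eq fun _ _ => rfl
  have hr : Isometry (Sum.inr : Y → X ⊕ Y) := Isometry.of_dist_eq fun _ _ => rfl
  have hc : CompactSpace (X ⊕ Y) := by
    rw [← isCompact_univ_iff, ← range_inl_union_range_inr]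
    exact (isCompact_range hl.continuous).union (isCompact_range hr.continuous)
  exact ⟨X ⊕ Y, inferInstance, hc, Sum.inl, Sum.inr, hl, hr, fun z hz =>
    (Metric.glueDist_glued_points (fun z : R => z.1.1) (fun z : R => z.1.2) ε ⟨z, hz⟩).le⟩

theorem objDist_le_of_isCorrespondence {m : ℕ} {κ : Fin m → Kind.{u}} {A B : Obj κ} {ε : ℝ≥0}
    {R : Set (A.carrier × B.carrier)} (hR : IsCorrespondence R) (hdis : distortion R ≤ 2 * ε)
    (hcomp : ∀ i, (κ i).Compatible R ε (A.str i) (B.str i)) : objDist A B ≤ ε := by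
  refine ENNReal.le_of_forall_pos_le_add fun δ hδ _ => ?_
  obtain ⟨Z, _, _, f, g, hf, hg, hfg⟩ := exists_isometry_dist_le hR
    (ε := ((ε + δ : ℝ≥0) : ℝ)) (NNReal.coe_pos.2 (add_pos_of_nonneg_of_pos ε.2 hδ))
    fun p hp q hq => (abs_dist_sub_dist_le_of_distortion_le hdis hp hq).trans (by
      push_cast
      linarith [δ.coe_nonneg])
  have hedist : ∀ z ∈ R, edist (f z.1) (g z.2) ≤ ((ε + δ : ℝ≥0) : ℝ≥0∞) := fun z hz => by
    rw [edist_dist]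
    exact ENNReal.ofReal_le_of_le_toReal (hfg z hz)
  refine iInf_le_of_le Z <| iInf_le_of_le _ <| iInf_le_of_le ‹_› <| iInf_le_of_le f <|
    iInf_le_of_le hf <| iInf_le_of_le g <| iInf_le_of_le hg <| ?_
  rw [← ENNReal.coe_add]
  refine max_le (Metric.hausdorffEDist_le_of_mem_edist ?_ ?_) (iSup_le fun i => ?_)
  · rintro _ ⟨x, rfl⟩
    obtain ⟨z, hz, rfl⟩ : x ∈ Prod.fst '' R := hR.1 ▸ mem_univ x
    exact ⟨_, mem_range_self z.2, hedist z hz⟩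
  · rintro _ ⟨y, rfl⟩
    obtain ⟨z, hz, rfl⟩ : y ∈ Prod.snd '' R := hR.2 ▸ mem_univ y
    refine ⟨_, mem_range_self z.1, ?_⟩
    rw [edist_comm]
    exact hedist z hz
  · exact ((hcomp i).mono le_self_add).strDist_push_le hf hg hfg

end Correspondence

/-! ### From embeddings to correspondences -/

section Limits

/-- By Arzelà–Ascoli there is a function `F` on `X × Y` which is a uniform limit of the cross
distances `d(f(x), g(y))` of nearly optimal embeddings `f`, `g`. -/
theorem exists_crossDist_of_objDist_le {m : ℕ} {κ : Fin m → Kind.{u}} {A B : Obj κ} {ε : ℝ≥0}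
    (h : objDist A B ≤ ε) :
    ∃ F : A.carrier × B.carrier → ℝ, Continuous F ∧ ∀ δ : ℝ≥0, 0 < δ →
      ∃ (Z : Type u) (_ : MetricSpace Z) (f : A.carrier → Z) (hf : Isometry f)
        (g : B.carrier → Z) (hg : Isometry g),
        Metric.hausdorffEDist (range f) (range g) < ((ε + δ : ℝ≥0) : ℝ≥0∞) ∧
        (∀ i, (κ i).strDist ((κ i).push f hf (A.str i)) ((κ i).push g hg (B.str i)) <
          ((ε + δ : ℝ≥0) : ℝ≥0∞)) ∧
        ∀ z, |dist (f z.1) (g z.2) - F z| ≤ δ := by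
  -- Each `f x` lies within `ε + 1` of some `g y`, and any other point of `range g` is within the
  -- diameter of `Y` from that one.
  set M : ℝ := ε + 1 + Metric.diam (univ : Set B.carrier) with hM
  set 𝒦 : Set (BoundedContinuousFunction (A.carrier × B.carrier) ℝ) :=
    {F | (∀ z w, dist (F z) (F w) ≤ (2 : ℝ≥0) * dist z w) ∧ ∀ z, F z ∈ Icc 0 M} with h𝒦
  have hcompact : IsCompact 𝒦 := by
    refine BoundedContinuousFunction.arzela_ascoli₂ (Icc 0 M) isCompact_Icc 𝒦 ?_
      (fun F z hF => hF.2 z) ?_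
    · have hev : ∀ z, Continuous fun F : BoundedContinuousFunction (A.carrier × B.carrier) ℝ =>
        F z := fun z => continuous_eval_const z
      simp only [h𝒦, ofPred_and, ofPred_forall]
      exact (isClosed_iInter fun z => isClosed_iInter fun w =>
        isClosed_le ((hev z).dist (hev w)) continuous_const).inter
        (isClosed_iInter fun z => isClosed_Icc.preimage (hev z))
    · exact (LipschitzWith.uniformEquicontinuous _ 2 fun F =>
        LipschitzWith.of_dist_le_mul F.2.1).equicontinuous
  have hseq : ∀ n : ℕ, ∃ F ∈ 𝒦, ∃ (Z : Type u) (_ : MetricSpace Z) (f : A.carrier → Z)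
      (hf : Isometry f) (g : B.carrier → Z) (hg : Isometry g),
      max (Metric.hausdorffEDist (range f) (range g))
        (tupleDist κ (tuplePush κ f hf A.str) (tuplePush κ g hg B.str)) <
        ((ε + 1 / (n + 1) : ℝ≥0) : ℝ≥0∞) ∧ ∀ z, F z = dist (f z.1) (g z.2) := by
    intro n
    have hlt : objDist A B < ((ε + 1 / (n + 1) : ℝ≥0) : ℝ≥0∞) :=
      h.trans_lt (ENNReal.coe_lt_coe.2 (lt_add_of_pos_right _ (by positivity)))
    simp only [objDist, iInf_lt_iff] at hlt
    obtain ⟨Z, iZ, -, f, hf, g, hg, hZ⟩ := hlt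
    have hc : Continuous fun z : A.carrier × B.carrier => dist (f z.1) (g z.2) :=
      (hf.continuous.comp continuous_fst).dist (hg.continuous.comp continuous_snd)
    refine ⟨BoundedContinuousFunction.mkOfCompact ⟨_, hc⟩, ⟨fun z w => ?_, fun z => ?_⟩, Z, iZ, f,
      hf, g, hg, hZ, fun z => rfl⟩
    · change dist (dist (f z.1) (g z.2)) (dist (f w.1) (g w.2)) ≤ _
      refine (dist_dist_dist_le _ _ _ _).trans ?_
      rw [hf.dist_eq, hg.dist_eq]
      have h1 : dist z.1 w.1 ≤ dist z w := le_max_left _ _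
      have h2 : dist z.2 w.2 ≤ dist z w := le_max_right _ _
      push_cast
      linarith
    · refine ⟨dist_nonneg, ?_⟩
      change dist (f z.1) (g z.2) ≤ M
      obtain ⟨_, ⟨y, rfl⟩, hy⟩ := Metric.exists_edist_lt_of_hausdorffEDist_lt
        (mem_range_self z.1) ((le_max_left _ _).trans_lt hZ)
      rw [edist_dist, ENNReal.ofReal_lt_iff_lt_toReal dist_nonneg ENNReal.coe_ne_top,
        ENNReal.coe_toReal] at hy
      push_cast at hy
      have h1 : (1 : ℝ) / (n + 1) ≤ 1 := (div_le_one (by positivity)).2 (by simp)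
      have h2 : dist (g y) (g z.2) ≤ Metric.diam (univ : Set B.carrier) := by
        rw [hg.dist_eq]
        exact Metric.dist_le_diam_of_mem isCompact_univ.isBounded (mem_univ _) (mem_univ _)
      linarith [dist_triangle (f z.1) (g y) (g z.2)]
  choose F hF hZ using hseq
  obtain ⟨F₀, -, φ, hφ, hlim⟩ := hcompact.tendsto_subseq hF
  refine ⟨F₀, F₀.continuous, fun δ hδ => ?_⟩
  have hsmall : ∀ᶠ n : ℕ in atTop, (1 : ℝ≥0) / (n + 1) < δ :=
    (tendsto_one_div_add_atTop_nhds_zero_nat (𝕜 := ℝ≥0)).eventually_lt_const hδ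
  obtain ⟨n, hn, hnδ⟩ := ((Metric.tendsto_nhds.1 hlim δ (NNReal.coe_pos.2 hδ)).and
    (hφ.tendsto_atTop.eventually hsmall)).exists
  obtain ⟨Z, iZ, f, hf, g, hg, hlt, heq⟩ := hZ (φ n)
  have hle : ((ε + 1 / ((φ n : ℕ) + 1) : ℝ≥0) : ℝ≥0∞) ≤ ((ε + δ : ℝ≥0) : ℝ≥0∞) :=
    ENNReal.coe_le_coe.2 (add_le_add le_rfl hnδ.le)
  refine ⟨Z, iZ, f, hf, g, hg, ((le_max_left _ _).trans_lt hlt).trans_le hle, fun i => ?_,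
    fun z => ?_⟩
  · exact ((le_iSup _ i).trans (le_max_right _ _)).trans_lt hlt |>.trans_le hle
  · rw [← heq]
    exact (BoundedContinuousFunction.dist_coe_le_dist z).trans hn.le

/-! ### Compactness and continuity as `δ` tends to `0` -/

variable {S T : Type*} [TopologicalSpace S] [TopologicalSpace T]

/-- Cantor's intersection theorem along `δ = 1 / (n + 1)`: matches that depend on `δ` are replaced
by one match valid for all `δ`. -/
theorem exists_mem_forall_pos_of_isCompact {K : Set T} (hK : IsCompact K) {E : ℝ≥0 → Set T}
    (hE : ∀ δ, IsClosed (E δ)) (hmono : Monotone E) (hne : ∀ δ, 0 < δ → (K ∩ E δ).Nonempty) :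
    ∃ y ∈ K, ∀ δ, 0 < δ → y ∈ E δ := by
  have hanti : Antitone fun n : ℕ => (1 : ℝ≥0) / (n + 1) := fun n k hnk =>
    one_div_le_one_div_of_le (by positivity) (by gcongr)
  have h : (K ∩ ⋂ n : ℕ, E (1 / (n + 1))).Nonempty := by
    refine hK.inter_iInter_nonempty _ (fun n => hE _) fun s => ?_
    obtain ⟨N, hN⟩ := s.exists_le
    obtain ⟨y, hyK, hy⟩ := hne (1 / (N + 1)) (by positivity)
    exact ⟨y, hyK, mem_iInter₂.2 fun n hn => hmono (hanti (hN n hn)) hy⟩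
  obtain ⟨y, hyK, hy⟩ := h
  refine ⟨y, hyK, fun δ hδ => ?_⟩
  obtain ⟨n, hn⟩ :=
    ((tendsto_one_div_add_atTop_nhds_zero_nat (𝕜 := ℝ≥0)).eventually_lt_const hδ).exists
  exact hmono hn.le (mem_iInter.1 hy n)

theorem isClosed_image_of_isCompact {B : Set S} (hB : IsCompact B) {N : Set (S × T)}
    (hN : IsClosed N) : IsClosed {y | ∃ x ∈ B, (x, y) ∈ N} := by
  have : CompactSpace B := isCompact_iff_compactSpace.1 hB
  have h : IsClosed ((fun z : B × T => ((z.1 : S), z.2)) ⁻¹' N) := hN.preimage (by fun_prop)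
  have himage := isClosedMap_snd_of_compactSpace _ h
  convert himage using 1
  ext y
  constructor
  · rintro ⟨x, hx, hxy⟩
    exact ⟨(⟨x, hx⟩, y), hxy, rfl⟩
  · rintro ⟨z, hz, rfl⟩
    exact ⟨z.1, z.1.2, hz⟩

/-- Continuity from above of the measure of the image of a compact set under closed relations. -/
theorem le_measure_image_of_forall_pos [MeasurableSpace T] [OpensMeasurableSpace T] {ν : Measure T}
    [IsFiniteMeasure ν] {B : Set S} (hB : IsCompact B) {N : ℝ≥0 → Set (S × T)}
    (hN : ∀ δ, IsClosed (N δ)) (hmono : Monotone N) {r : ℝ≥0∞} {ε : ℝ≥0}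
    (h : ∀ δ, 0 < δ → r ≤ ν {y | ∃ x ∈ B, (x, y) ∈ N δ} + ((ε + δ : ℝ≥0) : ℝ≥0∞)) :
    r ≤ ν {y | ∃ x ∈ B, ∀ δ, 0 < δ → (x, y) ∈ N δ} + ε := by
  have hanti : Antitone fun n : ℕ => (1 : ℝ≥0) / (n + 1) := fun n k hnk =>
    one_div_le_one_div_of_le (by positivity) (by gcongr)
  have hlim := tendsto_measure_iInter_atTop (μ := ν)
    (s := fun n : ℕ => {y | ∃ x ∈ B, (x, y) ∈ N (1 / (n + 1))})
    (fun n => (isClosed_image_of_isCompact hB (hN _)).measurableSet.nullMeasurableSet)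
    (fun n k hnk y ⟨x, hx, hxy⟩ => ⟨x, hx, hmono (hanti hnk) hxy⟩) ⟨0, measure_ne_top _ _⟩
  have hε : Tendsto (fun n : ℕ => ((ε + 1 / (n + 1) : ℝ≥0) : ℝ≥0∞)) atTop (𝓝 ε) := by
    rw [ENNReal.tendsto_coe]
    simpa using tendsto_const_nhds.add (tendsto_one_div_add_atTop_nhds_zero_nat (𝕜 := ℝ≥0))
  refine (ge_of_tendsto' (hlim.add hε) fun n => h _ (by positivity)).trans ?_
  refine add_le_add (measure_mono fun y hy => ?_) le_rfl
  -- Compactness of `B` is what makes the intersection of the images lie in the image of the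
  -- intersection.
  have hy' : ∀ n : ℕ, ∃ x ∈ B, (x, y) ∈ N (1 / (n + 1)) := mem_iInter.1 hy
  refine exists_mem_forall_pos_of_isCompact hB (E := fun δ => {x | (x, y) ∈ N δ})
    (fun δ => (hN δ).preimage (by fun_prop)) (fun δ δ' hδ x hx => hmono hδ hx) fun δ hδ => ?_
  obtain ⟨n, hn⟩ :=
    ((tendsto_one_div_add_atTop_nhds_zero_nat (𝕜 := ℝ≥0)).eventually_lt_const hδ).exists
  obtain ⟨x, hx, hxy⟩ := hy' n
  exact ⟨x, hx, hmono hn.le hxy⟩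

end Limits

/-! ### The sublevel set of the limiting cross distance -/

section Sublevel

/-- The relation `R_{k, ε + δ}` of the sublevel set `R = {F ≤ ε + δ}`. -/
def sublevelRel {X Y : Type u} (F : X × Y → ℝ) (k : ℕ) (Ξ : Type u) [MetricSpace Ξ]
    (ε δ : ℝ≥0) : Set (Marked k X Ξ × Marked k Y Ξ) :=
  markedRel {z | F z ≤ ε + δ} k Ξ (ε + δ)

theorem monotone_sublevelRel {X Y : Type u} (F : X × Y → ℝ) (k : ℕ) (Ξ : Type u) [MetricSpace Ξ]
    (ε : ℝ≥0) : Monotone (sublevelRel F k Ξ ε) := by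
  intro δ δ' h z hz
  have h' : (δ : ℝ) ≤ δ' := NNReal.coe_le_coe.2 h
  refine ⟨fun j => ?_, hz.2.trans (by push_cast; linarith)⟩
  have := hz.1 j
  rw [mem_ofPred_eq] at this ⊢
  linarith

theorem mem_markedRel_of_forall_pos {X Y : Type u} {F : X × Y → ℝ} {k : ℕ} {Ξ : Type u}
    [MetricSpace Ξ] {ε : ℝ≥0} {z : Marked k X Ξ × Marked k Y Ξ}
    (h : ∀ δ, 0 < δ → z ∈ sublevelRel F k Ξ ε δ) :
    z ∈ markedRel {z | F z ≤ ε} k Ξ ε := by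
  refine ⟨fun j => ?_, le_of_forall_pos_le_add fun δ hδ => ?_⟩
  · change F _ ≤ ε
    refine le_of_forall_pos_le_add fun δ hδ => ?_
    lift δ to ℝ≥0 using hδ.le
    exact (h δ (NNReal.coe_pos.1 hδ)).1 j
  · lift δ to ℝ≥0 using hδ.le
    exact (h δ (NNReal.coe_pos.1 hδ)).2

variable {X Y : Type u} [MetricSpace X] [MetricSpace Y]

instance Marked.instCompleteSpace {k : ℕ} {Ξ : Type u} [MetricSpace Ξ] [CompleteSpace X]
    [CompleteSpace Ξ] : CompleteSpace (Marked k X Ξ) :=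
  inferInstanceAs (CompleteSpace ((Fin k → X) × Ξ))

instance Marked.instSecondCountableTopology {k : ℕ} {Ξ : Type u} [MetricSpace Ξ]
    [SecondCountableTopology X] [SecondCountableTopology Ξ] :
    SecondCountableTopology (Marked k X Ξ) :=
  inferInstanceAs (SecondCountableTopology ((Fin k → X) × Ξ))

theorem isClosed_markedRel {R : Set (X × Y)} (hR : IsClosed R) (k : ℕ) (Ξ : Type u)
    [MetricSpace Ξ] (ε : ℝ≥0) : IsClosed (markedRel R k Ξ ε) := by
  have h : IsClosed {p : ((Fin k → X) × Ξ) × ((Fin k → Y) × Ξ) |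
      (∀ j, (p.1.1 j, p.2.1 j) ∈ R) ∧ dist p.1.2 p.2.2 ≤ ε} := by
    rw [ofPred_and, ofPred_forall]
    exact (isClosed_iInter fun j => hR.preimage (by fun_prop)).inter
      (isClosed_le (by fun_prop) continuous_const)
  exact h

/-- Embeddings which are nearly optimal for two structures, with cross distances close to `F`, make
the structures compatible with the sublevel set of `F`. -/
theorem compatible_sublevel [CompactSpace X] [CompactSpace Y] {F : X × Y → ℝ} (hF : Continuous F)
    {ε : ℝ≥0} {κ : Kind.{u}} {a : κ.Str X} {b : κ.Str Y}
    (h : ∀ δ : ℝ≥0, 0 < δ → ∃ (Z : Type u) (_ : MetricSpace Z) (f : X → Z) (hf : Isometry f)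
      (g : Y → Z) (hg : Isometry g),
      κ.strDist (κ.push f hf a) (κ.push g hg b) < ((ε + δ : ℝ≥0) : ℝ≥0∞) ∧
        ∀ z, |dist (f z.1) (g z.2) - F z| ≤ δ) :
    κ.Compatible {z | F z ≤ ε} ε a b := by
  have hsub : ∀ δ : ℝ≥0, IsClosed {z | F z ≤ ε + δ} := fun δ => isClosed_le hF continuous_const
  -- The budget `δ` is split in two: one half for near-optimality of the embeddings, one half for
  -- the distance between `F` and the true cross distance.
  have hmem : ∀ (k : ℕ) (Ξ : MarkSpace.{u}) (δ : ℝ≥0) {Z : Type u} [MetricSpace Z] {f : X → Z}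
      {g : Y → Z}, (∀ z, |dist (f z.1) (g z.2) - F z| ≤ (δ / 2 : ℝ≥0)) →
      ∀ (p : Marked k X Ξ) (q : Marked k Y Ξ),
        dist (Marked.map f p) (Marked.map g q) ≤ ((ε + δ / 2 : ℝ≥0) : ℝ) →
        (p, q) ∈ sublevelRel F k Ξ ε δ := by
    intro k Ξ δ Z _ f g hfg p q hpq
    obtain ⟨h₁, h₂⟩ := (Marked.dist_map_le_iff (NNReal.coe_nonneg _) p q).1 hpq
    have hδ := δ.coe_nonneg
    push_cast at h₁ h₂ hfg
    refine ⟨fun j => ?_, ?_⟩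
    · change F _ ≤ _
      have h₃ := (abs_le.1 (hfg (p.1 j, q.1 j))).1
      linarith [h₁ j]
    · change dist p.2 q.2 ≤ _
      push_cast
      linarith
  cases κ with
  | measure k Ξ =>
    change FiniteMeasure (Marked k X Ξ) at a
    change FiniteMeasure (Marked k Y Ξ) at b
    have hclosed : ∀ δ, IsClosed (sublevelRel F k Ξ ε δ) := fun δ => isClosed_markedRel (hsub δ) ..
    have hN : IsClosed (markedRel {z | F z ≤ ε} k Ξ ε) :=
      isClosed_markedRel (isClosed_le hF continuous_const) ..
    have hmono := monotone_sublevelRel F k Ξ ε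
    have : SecondCountableTopology (Ξ : Type u) := UniformSpace.secondCountable_of_separable _
    have h₁ : ∀ B : Set (Marked k X Ξ), IsCompact B → (a : Measure (Marked k X Ξ)) B ≤
        (b : Measure (Marked k Y Ξ)) {y | ∃ x ∈ B, (x, y) ∈ markedRel {z | F z ≤ ε} k Ξ ε} + ε := by
      intro B hB
      refine (le_measure_image_of_forall_pos hB hclosed hmono fun δ hδ => ?_).trans
        (add_le_add (measure_mono fun y ⟨x, hx, hxy⟩ =>
          ⟨x, hx, mem_markedRel_of_forall_pos hxy⟩) le_rfl)
      obtain ⟨Z, _, f, hf, g, hg, hlt, hfg⟩ := h (δ / 2) (half_pos hδ)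
      have cf := Marked.continuous_map (k := k) (Ξ := Ξ) hf
      have cg := Marked.continuous_map (k := k) (Ξ := Ξ) hg
      change levyProkhorovEDist ((a : Measure (Marked k X Ξ)).map (Marked.map f))
        ((b : Measure (Marked k Y Ξ)).map (Marked.map g)) < _ at hlt
      -- Compactness of `B` makes its image measurable, so that it is an admissible test set; the
      -- same compactness drives the passage to the limit.
      have hle := left_measure_le_of_levyProkhorovEDist_lt hlt (hB.image cf).measurableSet
      rw [Measure.map_apply cf.measurable (hB.image cf).measurableSet,
        Measure.map_apply cg.measurable Metric.isOpen_thickening.measurableSet] at hle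
      refine (measure_mono (subset_preimage_image _ _)).trans (hle.trans (add_le_add
        (measure_mono fun y hy => ?_) (ENNReal.coe_le_coe.2 (by gcongr; exact half_le_self δ.2))))
      obtain ⟨_, ⟨x, hx, rfl⟩, hxy⟩ := Metric.mem_thickening_iff.1 hy
      rw [dist_comm] at hxy
      exact ⟨x, hx, hmem k Ξ δ hfg x y hxy.le⟩
    have h₂ : ∀ C : Set (Marked k Y Ξ), IsCompact C → (b : Measure (Marked k Y Ξ)) C ≤
        (a : Measure (Marked k X Ξ)) {x | ∃ y ∈ C, (x, y) ∈ markedRel {z | F z ≤ ε} k Ξ ε} + ε := by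
      intro C hC
      refine (le_measure_image_of_forall_pos hC (N := fun δ => Prod.swap ⁻¹' sublevelRel F k Ξ ε δ)
        (fun δ => (hclosed δ).preimage continuous_swap)
        (fun δ δ' hδ => preimage_mono (hmono hδ)) fun δ hδ => ?_).trans
        (add_le_add (measure_mono fun x ⟨y, hy, hxy⟩ =>
          ⟨y, hy, mem_markedRel_of_forall_pos hxy⟩) le_rfl)
      obtain ⟨Z, _, f, hf, g, hg, hlt, hfg⟩ := h (δ / 2) (half_pos hδ)
      have cf := Marked.continuous_map (k := k) (Ξ := Ξ) hf
      have cg := Marked.continuous_map (k := k) (Ξ := Ξ) hg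
      change levyProkhorovEDist ((a : Measure (Marked k X Ξ)).map (Marked.map f))
        ((b : Measure (Marked k Y Ξ)).map (Marked.map g)) < _ at hlt
      have hle := right_measure_le_of_levyProkhorovEDist_lt hlt (hC.image cg).measurableSet
      rw [Measure.map_apply cg.measurable (hC.image cg).measurableSet,
        Measure.map_apply cf.measurable Metric.isOpen_thickening.measurableSet] at hle
      refine (measure_mono (subset_preimage_image _ _)).trans (hle.trans (add_le_add
        (measure_mono fun x hx => ?_) (ENNReal.coe_le_coe.2 (by gcongr; exact half_le_self δ.2))))
      obtain ⟨_, ⟨y, hy, rfl⟩, hxy⟩ := Metric.mem_thickening_iff.1 hx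
      exact ⟨y, hy, hmem k Ξ δ hfg x y hxy.le⟩
    obtain ⟨α, hα, hα₁, hα₂, hαR, hμ, hν⟩ := exists_measure_of_forall_isCompact
      (a : Measure (Marked k X Ξ)) (b : Measure (Marked k Y Ξ)) hN h₁ h₂
    exact exists_discrepancy_add_le hα₁ hα₂ hαR hμ hν
  | compact k Ξ =>
    change TopologicalSpace.Compacts (Marked k X Ξ) at a
    change TopologicalSpace.Compacts (Marked k Y Ξ) at b
    have hclosed : ∀ δ, IsClosed (sublevelRel F k Ξ ε δ) := fun δ => isClosed_markedRel (hsub δ) ..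
    have hmono := monotone_sublevelRel F k Ξ ε
    have hdist : ∀ {W : Type u} [MetricSpace W] {x y : W} {r : ℝ≥0}, edist x y < r → dist x y ≤ r :=
      fun {W} _ {x y r} hxy => by
        rw [edist_dist, ENNReal.ofReal_lt_iff_lt_toReal dist_nonneg ENNReal.coe_ne_top] at hxy
        exact hxy.le
    refine ⟨fun p hp => ?_, fun q hq => ?_⟩
    · obtain ⟨q, hq, hpq⟩ := exists_mem_forall_pos_of_isCompact b.isCompact
        (E := fun δ => {q | (p, q) ∈ sublevelRel F k Ξ ε δ})
        (fun δ => (hclosed δ).preimage (by fun_prop)) (fun δ δ' hδ q hq => hmono hδ hq)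
        fun δ hδ => by
          obtain ⟨Z, _, f, hf, g, hg, hlt, hfg⟩ := h (δ / 2) (half_pos hδ)
          obtain ⟨_, ⟨q, hq, rfl⟩, hpq⟩ := Metric.exists_edist_lt_of_hausdorffEDist_lt
            (mem_image_of_mem (Marked.map f) hp) hlt
          exact ⟨q, hq, hmem k Ξ δ hfg p q (hdist hpq)⟩
      exact ⟨q, hq, mem_markedRel_of_forall_pos hpq⟩
    · obtain ⟨p, hp, hpq⟩ := exists_mem_forall_pos_of_isCompact a.isCompact
        (E := fun δ => {p | (p, q) ∈ sublevelRel F k Ξ ε δ})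
        (fun δ => (hclosed δ).preimage (by fun_prop)) (fun δ δ' hδ p hp => hmono hδ hp)
        fun δ hδ => by
          obtain ⟨Z, _, f, hf, g, hg, hlt, hfg⟩ := h (δ / 2) (half_pos hδ)
          change Metric.hausdorffEDist (Marked.map f '' (a : Set (Marked k X Ξ)))
            (Marked.map g '' (b : Set (Marked k Y Ξ))) < _ at hlt
          rw [Metric.hausdorffEDist_comm] at hlt
          obtain ⟨_, ⟨p, hp, rfl⟩, hpq⟩ := Metric.exists_edist_lt_of_hausdorffEDist_lt
            (mem_image_of_mem (Marked.map g) hq) hlt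
          rw [edist_comm] at hpq
          exact ⟨p, hp, hmem k Ξ δ hfg p q (hdist hpq)⟩
      exact ⟨p, hp, mem_markedRel_of_forall_pos hpq⟩
  | curve =>
    change ConvergentCurve X at a
    change ConvergentCurve Y at b
    intro t
    change F (a.toFun t, b.toFun t) ≤ ε
    refine le_of_forall_pos_le_add fun δ hδ => ?_
    lift δ to ℝ≥0 using hδ.le
    obtain ⟨Z, _, f, hf, g, hg, hlt, hfg⟩ := h (δ / 2) (half_pos (NNReal.coe_pos.1 hδ))
    have ht : edist (f (a.toFun t)) (g (b.toFun t)) < ((ε + δ / 2 : ℝ≥0) : ℝ≥0∞) :=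
      (le_iSup (fun t => edist (f (a.toFun t)) (g (b.toFun t))) t).trans_lt hlt
    rw [edist_dist, ENNReal.ofReal_lt_iff_lt_toReal dist_nonneg ENNReal.coe_ne_top,
      ENNReal.coe_toReal] at ht
    have := (abs_le.1 (hfg (a.toFun t, b.toFun t))).1
    push_cast at ht this
    linarith

theorem exists_isCorrespondence_of_objDist_le {m : ℕ} {κ : Fin m → Kind.{u}} {A B : Obj κ}
    {ε : ℝ≥0} (h : objDist A B ≤ ε) :
    ∃ R : Set (A.carrier × B.carrier), IsCorrespondence R ∧ distortion R ≤ 2 * ε ∧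
      ∀ i, (κ i).Compatible R ε (A.str i) (B.str i) := by
  obtain ⟨F, hF, hlim⟩ := exists_crossDist_of_objDist_le h
  have hclosed : ∀ δ : ℝ≥0, IsClosed {z | F z ≤ ε + δ} := fun δ => isClosed_le hF continuous_const
  have hle : ∀ z, (∀ δ : ℝ≥0, 0 < δ → F z ≤ ε + δ) → F z ≤ ε := fun z hz =>
    le_of_forall_pos_le_add fun δ hδ => by
      lift δ to ℝ≥0 using hδ.le
      exact hz δ (NNReal.coe_pos.1 hδ)
  have hnear : ∀ {δ : ℝ≥0} {Z : Type u} [MetricSpace Z] {f : A.carrier → Z} {g : B.carrier → Z},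
      (∀ z, |dist (f z.1) (g z.2) - F z| ≤ (δ / 2 : ℝ≥0)) → ∀ x y,
      edist (f x) (g y) < ((ε + δ / 2 : ℝ≥0) : ℝ≥0∞) → F (x, y) ≤ ε + δ := by
    intro δ Z _ f g hfg x y hxy
    rw [edist_dist, ENNReal.ofReal_lt_iff_lt_toReal dist_nonneg ENNReal.coe_ne_top,
      ENNReal.coe_toReal] at hxy
    have := (abs_le.1 (hfg (x, y))).1
    push_cast at hxy this
    linarith
  refine ⟨{z | F z ≤ ε}, ⟨eq_univ_of_forall fun x => ?_, eq_univ_of_forall fun y => ?_⟩, ?_,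
    fun i => compatible_sublevel hF fun δ hδ => ?_⟩
  · obtain ⟨y, -, hy⟩ := exists_mem_forall_pos_of_isCompact (isCompact_univ (X := B.carrier))
      (E := fun δ => {y | F (x, y) ≤ ε + δ}) (fun δ => (hclosed δ).preimage (by fun_prop))
      (fun δ δ' hδ y hy => le_trans hy (add_le_add le_rfl (NNReal.coe_le_coe.2 hδ))) fun δ hδ => by
        obtain ⟨Z, _, f, hf, g, hg, hlt, -, hfg⟩ := hlim (δ / 2) (half_pos hδ)
        obtain ⟨_, ⟨y, rfl⟩, hxy⟩ := Metric.exists_edist_lt_of_hausdorffEDist_lt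
          (mem_range_self x) hlt
        exact ⟨y, mem_univ y, hnear hfg x y hxy⟩
    exact ⟨(x, y), hle _ hy, rfl⟩
  · obtain ⟨x, -, hx⟩ := exists_mem_forall_pos_of_isCompact (isCompact_univ (X := A.carrier))
      (E := fun δ => {x | F (x, y) ≤ ε + δ}) (fun δ => (hclosed δ).preimage (by fun_prop))
      (fun δ δ' hδ x hx => le_trans hx (add_le_add le_rfl (NNReal.coe_le_coe.2 hδ))) fun δ hδ => by
        obtain ⟨Z, _, f, hf, g, hg, hlt, -, hfg⟩ := hlim (δ / 2) (half_pos hδ)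
        rw [Metric.hausdorffEDist_comm] at hlt
        obtain ⟨_, ⟨x, rfl⟩, hxy⟩ := Metric.exists_edist_lt_of_hausdorffEDist_lt
          (mem_range_self y) hlt
        rw [edist_comm] at hxy
        exact ⟨x, mem_univ x, hnear hfg x y hxy⟩
    exact ⟨(x, y), hle _ hx, rfl⟩
  · refine iSup₂_le fun p hp => iSup₂_le fun q hq => ?_
    refine ENNReal.ofReal_le_of_le_toReal ?_
    rw [ENNReal.toReal_mul, ENNReal.toReal_ofNat, ENNReal.coe_toReal]
    refine le_of_forall_pos_le_add fun δ hδ => ?_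
    lift δ to ℝ≥0 using hδ.le
    obtain ⟨Z, _, f, hf, g, hg, -, -, hfg⟩ := hlim (δ / 2) (half_pos (NNReal.coe_pos.1 hδ))
    have hp' : F p ≤ ε := hp
    have hq' : F q ≤ ε := hq
    have h1 := (abs_le.1 (hfg p)).2
    have h2 := (abs_le.1 (hfg q)).2
    -- The two distances differ by at most the sum of the two cross distances, each at most `ε + δ /
    -- 2`.
    have h3 := dist_dist_dist_le (f p.1) (f q.1) (g p.2) (g q.2)
    rw [hf.dist_eq, hg.dist_eq, Real.dist_eq] at h3
    push_cast at h1 h2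
    linarith
  · obtain ⟨Z, iZ, f, hf, g, hg, -, hlt, hfg⟩ := hlim δ hδ
    exact ⟨Z, iZ, f, hf, g, hg, hlt i, hfg⟩

end Sublevel

end GHFunctor

end

theorem proposition3p16 {m : ℕ} (κ : Fin m → GHFunctor.Kind.{u})
    (X : Type u) [MetricSpace X] [CompactSpace X] (a : GHFunctor.Tuple κ X)
    (Y : Type u) [MetricSpace Y] [CompactSpace Y] (b : GHFunctor.Tuple κ Y) (ε : ℝ≥0) :
    GHFunctor.ghDist (GHFunctor.toSpace κ X a) (GHFunctor.toSpace κ Y b) ≤ ε ↔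
      ∃ R : Set (X × Y), GHFunctor.IsCorrespondence R ∧
        GHFunctor.distortion R ≤ 2 * ε ∧
        ∀ i, GHFunctor.Kind.Compatible R ε (κ i) (a i) (b i) := by
  change GHFunctor.objDist (κ := κ) ⟨X, a⟩ ⟨Y, b⟩ ≤ ε ↔ _
  exact ⟨fun h => GHFunctor.exists_isCorrespondence_of_objDist_le h,
    fun ⟨_, hR, hdis, hcomp⟩ => GHFunctor.objDist_le_of_isCorrespondence (κ := κ)
      (A := ⟨X, a⟩) (B := ⟨Y, b⟩) hR hdis hcomp⟩
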